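/- Let $n\ge 1$, let $\mathfrak S_{n+1}$ be the symmetric group with simple transpositions $s_i=(i,i+1)$, $i\in[n]=\{1,\dots,n\}$, and let $w_0$ be its longest element ($n{+}1\ n\ \cdots\ 1$ in one-line notation). A reduced word of $w_0$ is a word $\mathbf i=(i_1,\dots,i_\ell)\in[n]^\ell$ of minimal length with $s_{i_1}\cdots s_{i_\ell}=w_0$. Two reduced words are in the same commutation class, $\mathbf i\sim\mathbf j$, if one is obtained from the other by a sequence of exchanges of two consecutive letters $i,j$ with $|i-j|>1$. A word poset is a poset $P$ with a function $f_P:P\to\mathbb Z_{>0}$; an isomorphism $P\sim Q$ is a poset isomorphism $\phi$ with $f_Q\circ\phi=f_P$. The word poset $P_{\mathbf i}$ of $\mathbf i=(i_1,\dots,i_\ell)$ is $[\ell]$ with $f(j)=i_j$, ordered by the reflexive transitive closure of the relations $(j,k)$ with $j<k$ and $|i_j-i_k|=1$. Let $\mathcal P(w_0)$ be the class of word posets isomorphic to $P_{\mathbf i}$ for some reduced word $\mathbf i$ of $w_0$. For $P\in\mathcal P(w_0)$, the ascending chain $\mathsf A(P)=\{a_1<\dots<a_n\}$ and the descending chain $\mathsf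 D(P)=\{d_1<\dots<d_n\}$ are the unique chains in $P$ with $f_P(a_i)=i$, respectively $f_P(d_i)=n+1-i$, for all $i\in[n]$. For $\varepsilon\in\{\mathsf A,\mathsf D\}$ with corresponding chain $K$, let $\mathrm{ind}_\varepsilon(P)$ be the number of $k\in P$ such that $k>x$ and $f_P(k)=f_P(x)$ for some $x\in K$, and let $I_\varepsilon(P)$ be the set of $k\in P$ such that $k<x$ and $f_P(k)=f_P(x)$ for some $x\in K$. The contraction $C_\varepsilon(P)$ is $P\setminus K$ with the induced order, where $f_{C_{\mathsf A}(P)}$ equals $f_P-1$ on $I_{\mathsf A}(P)$ and $f_P$ elsewhere, and $f_{C_{\mathsf D}(P)}$ equals $f_P$ on $I_{\mathsf D}(P)$ and $f_P-1$ elsewhere. These definitions are iterated, with $n$ replaced by $n-1$ after each contraction. For $\delta=(\delta_1,\dots,\delta_{n-1})\in\{\mathsf A,\mathsf D\}^{n-1}$ the $\delta$-index is $\mathrm{ind}_\delta(P)=(I_1,\dots,I_{n-1})$ with $$I_k=\mathrm{ind}_{\delta_k}\bigl(C_{\delta_{k+1}}\circ\cdots\circ C_{\delta_{n-1}}(P)\bigr),\qquad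 1\le k\le n-1,$$ and $\mathrm{ind}_\delta(\mathbf i)=\mathrm{ind}_\delta(P_{\mathbf i})$. **Theorem.** (1) If $P,Q\in\mathcal P(w_0)$ satisfy $\mathrm{ind}_\delta(P)=\mathrm{ind}_\delta(Q)$ for every $\delta\in\{\mathsf A,\mathsf D\}^{n-1}$, then $P\sim Q$. (2) If $\mathbf i,\mathbf j$ are reduced words of $w_0$ with $\mathrm{ind}_\delta(\mathbf i)=\mathrm{ind}_\delta(\mathbf j)$ for every $\delta\in\{\mathsf A,\mathsf D\}^{n-1}$, then $\mathbf i\sim\mathbf j$. -/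

import Mathlib

universe u v

/-! ### Reduced words and commutation classes

The alphabet `[n] = {1, …, n}` is modelled by `Fin n`: the element `i : Fin n` stands for the
letter `i + 1`. -/

/-- The simple transposition of `S_{n+1}` exchanging `i + 1` and `i + 2`
(one-based; these are `i` and `i + 1` in `Fin (n + 1)`). -/
def simpleTransposition {n : ℕ} (i : Fin n) : Equiv.Perm (Fin (n + 1)) :=
  Equiv.swap i.castSucc i.succ

/-- The product `s_{i_1} s_{i_2} ⋯ s_{i_r}` of a word. -/
def wordProd {n : ℕ} (l : List (Fin n)) : Equiv.Perm (Fin (n + 1)) :=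
  (l.map simpleTransposition).prod

/-- `l` is a reduced word of `w`: a word of `w` of the smallest possible length. -/
def IsReducedWord {n : ℕ} (w : Equiv.Perm (Fin (n + 1))) (l : List (Fin n)) : Prop :=
  wordProd l = w ∧ ∀ l' : List (Fin n), wordProd l' = w → l.length ≤ l'.length

/-- The longest element `n+1 n … 1` (one-line notation) of `S_{n+1}`. -/
def longestElement (n : ℕ) : Equiv.Perm (Fin (n + 1)) := Fin.revPerm

/-- A 2-move: two consecutive letters `i, j` with `|i - j| > 1` are exchanged. -/
inductive TwoMove {n : ℕ} : List (Fin n) → List (Fin n) → Prop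
  | swap (l r : List (Fin n)) (i j : Fin n) (h : 1 < |((i : ℕ) : ℤ) - ((j : ℕ) : ℤ)|) :
      TwoMove (l ++ i :: j :: r) (l ++ j :: i :: r)

/-- Two words are in the same commutation class if one is obtained from the other by a sequence
of 2-moves (a 2-move is its own inverse, so this is an equivalence relation). -/
def CommutationEquiv {n : ℕ} (l l' : List (Fin n)) : Prop :=
  Relation.ReflTransGen TwoMove l l'

/-! ### Word posets -/

/-- A word poset: a poset `P` with a function `f_P : P → ℤ_{>0}`, here called `col`. -/
structure WordPoset where
  carrier : Type u
  order : PartialOrder carrier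
  col : carrier → ℕ+

namespace WordPoset

instance : CoeSort WordPoset.{u} (Type u) := ⟨WordPoset.carrier⟩

instance (P : WordPoset.{u}) : PartialOrder P := P.order

/-- Isomorphism of word posets: a poset isomorphism that respects the columns. -/
def Iso (P : WordPoset.{u}) (Q : WordPoset.{v}) : Prop :=
  ∃ φ : P ≃o Q, ∀ x : P, P.col x = Q.col (φ x)

end WordPoset

/-- The generating relation of the word poset of `l`: `j < k` and `|i_j - i_k| = 1`. -/
def wordRel {n : ℕ} (l : List (Fin n)) (j k : Fin l.length) : Prop :=
  j < k ∧ |((l.get j : ℕ) : ℤ) - ((l.get k : ℕ) : ℤ)| = 1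

theorem le_of_reflTransGen_wordRel {n : ℕ} (l : List (Fin n)) {j k : Fin l.length}
    (h : Relation.ReflTransGen (wordRel l) j k) : j ≤ k := by
  induction h with
  | refl => exact le_rfl
  | tail _ h ih => exact ih.trans h.1.le

/-- The word poset of a word `i_1 … i_ℓ`: the positions, ordered by the reflexive transitive
closure of `wordRel`, the position `j` lying in column `i_j`. -/
def wordPoset {n : ℕ} (l : List (Fin n)) : WordPoset.{0} where
  carrier := Fin l.length
  order :=
    { le := Relation.ReflTransGen (wordRel l)
      lt := fun j k =>
        Relation.ReflTransGen (wordRel l) j k ∧ ¬ Relation.ReflTransGen (wordRel l) k j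
      lt_iff_le_not_ge := fun _ _ => Iff.rfl
      le_refl := fun _ => Relation.ReflTransGen.refl
      le_trans := fun _ _ _ => Relation.ReflTransGen.trans
      le_antisymm := fun _ _ h h' =>
        le_antisymm (le_of_reflTransGen_wordRel l h) (le_of_reflTransGen_wordRel l h') }
  col := fun j => Nat.succPNat (l.get j)

/-- `P` is isomorphic to the word poset of some reduced word of `w`. -/
def WordPoset.IsWordPosetOf {n : ℕ} (P : WordPoset.{u}) (w : Equiv.Perm (Fin (n + 1))) : Prop :=
  ∃ l : List (Fin n), IsReducedWord w l ∧ P.Iso (wordPoset l)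

/-! ### Ascending and descending chains, indices, contractions -/

/-- The two letters `A` (ascending) and `D` (descending). -/
inductive Direction
  | A
  | D

namespace WordPoset

/-- `c` lists, in increasing order, a chain of `n` elements which lie in the columns
`1, 2, …, n` (direction `A`), respectively `n, n - 1, …, 1` (direction `D`). -/
def IsDirectedChain (P : WordPoset.{u}) (n : ℕ) : Direction → (Fin n → P) → Prop
  | .A, c => StrictMono c ∧ ∀ i : Fin n, (P.col (c i) : ℕ) = i + 1
  | .D, c => StrictMono c ∧ ∀ i : Fin n, (P.col (c i) : ℕ) = n - i

/-- The ascending chain `A(P)`, respectively the descending chain `D(P)`, as a subset of `P`.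
For the word posets of the longest element of `S_{n+1}` and their iterated contractions there is
exactly one chain `c` as required, so that this is the underlying set of that chain. -/
def directedChain (P : WordPoset.{u}) (n : ℕ) (ε : Direction) : Set P :=
  {x | ∃ c : Fin n → P, P.IsDirectedChain n ε c ∧ x ∈ Set.range c}

/-- The `A`-index, respectively `D`-index: the number of elements of `P` that lie above the
ascending, respectively descending, chain, that is, above the element of the chain in their own
column. (The columns of the elements of the chain being distinct, this is the sum over the
elements `x` of the chain of the number of `k > x` in the column of `x`.) -/
noncomputable def ind (P : WordPoset.{u}) (n : ℕ) (ε : Direction) : ℕ :=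
  {k : P | ∃ x ∈ P.directedChain n ε, x < k ∧ P.col k = P.col x}.ncard

/-- The contraction ideals `I_A(P)` and `I_D(P)`: the elements below the element of the chain in
their own column. -/
def contractionIdeal (P : WordPoset.{u}) (n : ℕ) (ε : Direction) : Set P :=
  {k : P | ∃ x ∈ P.directedChain n ε, k < x ∧ P.col k = P.col x}

open Classical in
/-- The contractions `C_A(P)` and `C_D(P)`: the chain is removed and the order is the induced one.
For `A` the elements of the contraction ideal are shifted to the left by one column, for `D` the
elements outside of it. (No element that is shifted is in column `1` when `P` comes from a reduced
word of the longest element.) -/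
noncomputable def contraction (P : WordPoset.{u}) (n : ℕ) (ε : Direction) : WordPoset.{u} where
  carrier := {x : P // x ∉ P.directedChain n ε}
  order := inferInstance
  col := fun k =>
    match ε with
    | .A => if k.1 ∈ P.contractionIdeal n .A then P.col k.1 - 1 else P.col k.1
    | .D => if k.1 ∈ P.contractionIdeal n .D then P.col k.1 else P.col k.1 - 1

/-- The `δ`-index `(I_1, …, I_{n-1})` of `P`, for `δ = (δ_1, …, δ_{n-1})`, where
`I_k = ind_{δ_k} (C_{δ_{k+1}} ∘ ⋯ ∘ C_{δ_{n-1}} (P))`. Thus the last entry is `ind_{δ_{n-1}} (P)`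
and the entries before it form the `(δ_1, …, δ_{n-2})`-index of `C_{δ_{n-1}} (P)`. -/
noncomputable def deltaIndex :
    (n : ℕ) → (Fin (n - 1) → Direction) → WordPoset.{u} → (Fin (n - 1) → ℕ)
  | 0, _, _ => Fin.elim0
  | 1, _, _ => Fin.elim0
  | n + 2, δ, P =>
      Fin.snoc (α := fun _ : Fin (n + 1) => ℕ)
        (deltaIndex (n + 1) (fun k : Fin n => δ k.castSucc)
          (P.contraction (n + 2) (δ (Fin.last n))))
        (P.ind (n + 2) (δ (Fin.last n)))

end WordPoset

/-- The `δ`-index of a word is that of its word poset. -/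
noncomputable def wordDeltaIndex {n : ℕ} (δ : Fin (n - 1) → Direction) (l : List (Fin n)) :
    Fin (n - 1) → ℕ :=
  WordPoset.deltaIndex n δ (wordPoset l)

/-!
A reduced word of the longest element is a wiring diagram of `n + 1` strands in which every two
strands cross exactly once, and its word poset consists of the crossings. The ascending chain is
the set of crossings on the smallest strand: that strand climbs from the bottom to the top, and a
chain through the columns `1, …, n` can never get above it, nor catch up with it once it has
fallen behind (`IsClimb.eq_of_strictMono`, `directedChain_subPoset`). Likewise the descending chain
is the set of crossings on the greatest strand. Hence a contraction removes an extreme strand, and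
the columns become those of the arrangement of the remaining strands (`contraction_subPoset_iso`).
The order induced on a contraction may have more relations than the word poset of the smaller
arrangement, but it has the comparabilities that matter: crossings on a common strand, and
crossings in a common column of the smaller arrangement (`reflTransGen_of_common_strand`,
`reflTransGen_of_relHeight_eq`).

Three strands `a < j < b` cross in lexicographic order, `ab` being the middle crossing and `aj` the
first one, or in the opposite order (`crossTime_triple`). All `δ`-indices together give, for every
interval `[a, b]` of strands, the ascending index of the arrangement on it, which is the number of
lexicographic triples `a < j < k ≤ b` (`ind_subPoset_Icc`); so they give, for all `a < b`, the
number of the `j` between them for which `a < j < b` is lexicographic. By induction on `b - a` this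
determines these `j`: they are the strands that `a` meets before `b`, an initial segment of the
order, already known, in which `a` meets the strands between `a` and `b`
(`lexicographic_of_card_eq`). Finally, the lexicographic triples determine the order of the
crossings on each strand, and thereby the commutation class
(`commutationEquiv_of_lexicographic_iff`): the first crossing of one word can be moved to the front
of the other by 2-moves. Statement (1) follows from (2), as words in the same commutation class
have isomorphic word posets (`CommutationEquiv.iso`).
-/

universe w x

/-! ### Wiring diagrams -/

/-- The wiring diagram of a word `l`: `strandAt l t` sends a height to the strand (named by its
height at the beginning) that is found there just before the letter number `t`. -/
def strandAt {n : ℕ} (l : List (Fin n)) (t : ℕ) : Equiv.Perm (Fin (n + 1)) :=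
  wordProd (l.take t)

/-- The height of the strand `y` just before the letter number `t`. -/
def height {n : ℕ} (l : List (Fin n)) (t : ℕ) (y : Fin (n + 1)) : Fin (n + 1) :=
  (strandAt l t).symm y

/-- The strand that goes up at the crossing number `t`. -/
def lowStrand {n : ℕ} (l : List (Fin n)) (t : Fin l.length) : Fin (n + 1) :=
  strandAt l t (l.get t).castSucc

/-- The strand that goes down at the crossing number `t`. -/
def highStrand {n : ℕ} (l : List (Fin n)) (t : Fin l.length) : Fin (n + 1) :=
  strandAt l t (l.get t).succ

section Wiring

variable {n : ℕ} {l : List (Fin n)}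

theorem wordProd_append (l₁ l₂ : List (Fin n)) :
    wordProd (l₁ ++ l₂) = wordProd l₁ * wordProd l₂ := by
  simp [wordProd]

theorem strandAt_zero (l : List (Fin n)) : strandAt l 0 = 1 := by simp [strandAt, wordProd]

theorem strandAt_succ (t : Fin l.length) :
    strandAt l (t + 1) = strandAt l t * simpleTransposition (l.get t) := by
  rw [strandAt, ← List.take_concat_get' l t t.2, wordProd_append]
  simp [strandAt, wordProd]

theorem strandAt_succ' (t : Fin l.length) :
    strandAt l (t + 1) = Equiv.swap (lowStrand l t) (highStrand l t) * strandAt l t := by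
  rw [strandAt_succ, simpleTransposition, Equiv.mul_swap_eq_swap_mul]; rfl

theorem height_injective (l : List (Fin n)) (t : ℕ) : Function.Injective (height l t) :=
  (strandAt l t).symm.injective

theorem height_zero (l : List (Fin n)) (y : Fin (n + 1)) : height l 0 y = y := by
  rw [height, strandAt_zero]; rfl

theorem height_lowStrand (t : Fin l.length) :
    height l t (lowStrand l t) = (l.get t).castSucc := by
  simp [height, lowStrand]

theorem height_highStrand (t : Fin l.length) :
    height l t (highStrand l t) = (l.get t).succ := by
  simp [height, highStrand]

theorem height_highStrand_val (t : Fin l.length) :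
    (height l t (highStrand l t) : ℕ) = height l t (lowStrand l t) + 1 := by
  simp [height_highStrand, height_lowStrand]

theorem height_succ (t : Fin l.length) (y : Fin (n + 1)) :
    height l (t + 1) y = height l t (Equiv.swap (lowStrand l t) (highStrand l t) y) := by
  rw [height, strandAt_succ', height, ← Equiv.Perm.inv_def, mul_inv_rev, Equiv.swap_inv,
    Equiv.Perm.mul_apply]; rfl

theorem height_succ_low (t : Fin l.length) :
    height l (t + 1) (lowStrand l t) = height l t (highStrand l t) := by
  simp [height_succ]

theorem height_succ_high (t : Fin l.length) :
    height l (t + 1) (highStrand l t) = height l t (lowStrand l t) := by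
  simp [height_succ]

theorem height_succ_of_ne (t : Fin l.length) {y : Fin (n + 1)} (h₁ : y ≠ lowStrand l t)
    (h₂ : y ≠ highStrand l t) : height l (t + 1) y = height l t y := by
  rw [height_succ, Equiv.swap_apply_of_ne_of_ne h₁ h₂]

/-- Only the two strands of a crossing change their relative position there. -/
theorem eq_strands_of_height_lt (t : Fin l.length) {y z : Fin (n + 1)}
    (h : height l t y < height l t z) (h' : height l (t + 1) z < height l (t + 1) y) :
    lowStrand l t = y ∧ highStrand l t = z := by
  have hh := height_highStrand_val t
  have e1 := height_succ_low t
  have e2 := height_succ_high t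
  have inj := height_injective l t
  have key : ∀ w, w ≠ lowStrand l t → w ≠ highStrand l t →
      (height l t w : ℕ) ≠ height l t (lowStrand l t) ∧
      (height l t w : ℕ) ≠ height l t (highStrand l t) := fun w h1 h2 =>
    ⟨fun e => h1 (inj (Fin.ext e)), fun e => h2 (inj (Fin.ext e))⟩
  by_cases y1 : y = lowStrand l t
  · by_cases z2 : z = highStrand l t
    · exact ⟨y1.symm, z2.symm⟩
    · have z1 : z ≠ lowStrand l t := by rintro rfl; subst y1; exact absurd h (lt_irrefl _)
      have := key z z1 z2
      rw [height_succ_of_ne t z1 z2, y1, e1, Fin.lt_def] at h'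
      rw [y1, Fin.lt_def] at h
      omega
  by_cases y2 : y = highStrand l t
  · by_cases z1 : z = lowStrand l t
    · rw [y2, z1, Fin.lt_def] at h; omega
    · have z2 : z ≠ highStrand l t := by rintro rfl; subst y2; exact absurd h (lt_irrefl _)
      have := key z z1 z2
      rw [height_succ_of_ne t z1 z2, y2, e2, Fin.lt_def] at h'
      rw [y2, Fin.lt_def] at h
      omega
  have hy := key y y1 y2
  rw [height_succ_of_ne t y1 y2, Fin.lt_def] at h'
  rw [Fin.lt_def] at h
  by_cases z1 : z = lowStrand l t
  · rw [z1, e1] at h'; rw [z1] at h; omega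
  by_cases z2 : z = highStrand l t
  · rw [z2, e2] at h'; rw [z2] at h; omega
  rw [height_succ_of_ne t z1 z2] at h'
  omega

/-- Two strands that change their relative position cross in between. -/
theorem exists_crossing {y z : Fin (n + 1)} {s t : ℕ} (hst : s ≤ t) (ht : t ≤ l.length)
    (h : height l s y < height l s z) (h' : height l t z < height l t y) :
    ∃ r : Fin l.length, s ≤ r ∧ r < t ∧ lowStrand l r = y ∧ highStrand l r = z := by
  induction t, hst using Nat.le_induction with
  | base => exact absurd h h'.asymm
  | succ t hst ih =>
    rcases lt_trichotomy (height l t y) (height l t z) with h1 | h1 | h1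
    · exact ⟨⟨t, ht⟩, hst, Nat.lt_succ_self _, eq_strands_of_height_lt ⟨t, ht⟩ h1 h'⟩
    · rw [height_injective l t h1] at h; exact absurd h (lt_irrefl _)
    · obtain ⟨r, h2, h3, h4⟩ := ih (by omega) h1
      exact ⟨r, h2, by omega, h4⟩

/-- In a reduced word the two strands of a crossing have not crossed before: otherwise both
crossings could be deleted from the word. -/
theorem IsReducedWord.lowStrand_lt_highStrand {w : Equiv.Perm (Fin (n + 1))}
    (hl : IsReducedWord w l) (t : Fin l.length) : lowStrand l t < highStrand l t := by
  by_contra hlt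
  have hne : lowStrand l t ≠ highStrand l t := by
    intro h
    have := (strandAt l t).injective h
    simp [Fin.ext_iff] at this
  have hlt : highStrand l t < lowStrand l t := lt_of_le_of_ne (not_lt.1 hlt) hne.symm
  obtain ⟨s, -, hst, h1, h2⟩ := exists_crossing (l := l) (y := highStrand l t)
    (z := lowStrand l t) (Nat.zero_le (t : ℕ)) t.2.le (by simpa [height_zero] using hlt)
    (by rw [Fin.lt_def, height_highStrand_val]; omega)
  -- The word `l` is `l.take s`, the letter `s`, this middle part, the letter `t`, `l.drop (t + 1)`.
  have hmid : l.take t = l.take (s + 1) ++ (l.take t).drop (s + 1) := by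
    conv_lhs => rw [← List.take_append_drop (s + 1) (l.take t)]
    rw [List.take_take, min_eq_left (by omega)]
  have e1 : strandAt l t = strandAt l (s + 1) * wordProd ((l.take t).drop (s + 1)) := by
    rw [strandAt, hmid, wordProd_append, ← hmid]; rfl
  have e2 : strandAt l (t + 1) = strandAt l s * wordProd ((l.take t).drop (s + 1)) := by
    rw [strandAt_succ', e1, strandAt_succ' s, h1, h2, Equiv.swap_comm (highStrand l t), ← mul_assoc,
      ← mul_assoc, Equiv.swap_mul_self, one_mul]
  have e3 : wordProd (l.take s ++ (l.take t).drop (s + 1) ++ l.drop (t + 1)) = w := by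
    rw [wordProd_append, wordProd_append]
    change strandAt l s * _ * _ = w
    rw [← e2, strandAt, ← wordProd_append, List.take_append_drop, hl.1]
  have := hl.2 _ e3
  have hs := s.2
  have ht := t.2
  simp only [List.length_append, List.length_take, List.length_drop] at this
  omega

variable (hl : IsReducedWord (longestElement n) l)
include hl

theorem height_length (y : Fin (n + 1)) : height l l.length y = Fin.rev y := by
  rw [height, strandAt, List.take_length, hl.1, longestElement]; rfl

/-- Strands that have crossed remain so. -/
theorem crossed_mono {y z : Fin (n + 1)} (hyz : y < z) {s t : ℕ} (hst : s ≤ t)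
    (ht : t ≤ l.length) (h : height l s z < height l s y) : height l t z < height l t y := by
  by_contra h'
  have h' := lt_of_le_of_ne (not_lt.1 h') fun e => hyz.ne (height_injective l t e)
  obtain ⟨r, -, -, h1, h2⟩ := exists_crossing hst ht h h'
  have := hl.lowStrand_lt_highStrand r
  rw [h1, h2] at this
  exact absurd this hyz.asymm

end Wiring

/-- The time of the crossing of the strands `a < b` in a reduced word of the longest element: the
first time after which `b` is below `a`. (Without meaning if `b ≤ a`.) -/
noncomputable def crossTime {n : ℕ} (l : List (Fin n)) (a b : Fin (n + 1)) : ℕ :=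
  sInf {t | height l (t + 1) b < height l (t + 1) a}

section CrossTime

variable {n : ℕ} {l : List (Fin n)}
  (hl : IsReducedWord (longestElement n) l)
include hl

theorem crossed_length {a b : Fin (n + 1)} (hab : a < b) :
    height l l.length b < height l l.length a := by
  rw [height_length hl, height_length hl]
  exact Fin.rev_lt_rev.2 hab

theorem length_pos_of_lt {a b : Fin (n + 1)} (hab : a < b) : 0 < l.length := by
  by_contra h
  have := crossed_length hl hab
  rw [Nat.eq_zero_of_not_pos h, height_zero, height_zero] at this
  exact absurd this hab.asymm

theorem crossTime_nonempty {a b : Fin (n + 1)} (hab : a < b) :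
    l.length - 1 ∈ {t | height l (t + 1) b < height l (t + 1) a} := by
  have := length_pos_of_lt hl hab
  change height l (l.length - 1 + 1) b < height l (l.length - 1 + 1) a
  rw [Nat.sub_add_cancel this]
  exact crossed_length hl hab

theorem crossTime_lt_length {a b : Fin (n + 1)} (hab : a < b) : crossTime l a b < l.length := by
  have h1 := Nat.sInf_le (crossTime_nonempty hl hab)
  have := length_pos_of_lt hl hab
  rw [← crossTime] at h1
  omega

theorem height_lt_iff_le_crossTime {a b : Fin (n + 1)} (hab : a < b) {t : ℕ} (ht : t ≤ l.length) :
    height l t a < height l t b ↔ t ≤ crossTime l a b := by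
  constructor
  · intro h
    by_contra hc
    have h1 : height l (crossTime l a b + 1) b < height l (crossTime l a b + 1) a :=
      Nat.sInf_mem ⟨_, crossTime_nonempty hl hab⟩
    exact absurd (crossed_mono hl hab (not_le.1 hc) ht h1) h.asymm
  · intro h
    rcases t with _ | t
    · simpa [height_zero] using hab
    · have : ¬ height l (t + 1) b < height l (t + 1) a := fun e =>
        absurd (Nat.sInf_le (s := {t | height l (t + 1) b < height l (t + 1) a}) e)
          (not_le.2 h)
      exact lt_of_le_of_ne (not_lt.1 this) fun e => hab.ne (height_injective l _ e)

theorem strands_crossTime {a b : Fin (n + 1)} (hab : a < b) :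
    lowStrand l ⟨crossTime l a b, crossTime_lt_length hl hab⟩ = a ∧
    highStrand l ⟨crossTime l a b, crossTime_lt_length hl hab⟩ = b := by
  apply eq_strands_of_height_lt
  · exact (height_lt_iff_le_crossTime hl hab (crossTime_lt_length hl hab).le).2 le_rfl
  · exact Nat.sInf_mem (s := {t | height l (t + 1) b < height l (t + 1) a})
      ⟨_, crossTime_nonempty hl hab⟩

theorem crossTime_strands (t : Fin l.length) :
    crossTime l (lowStrand l t) (highStrand l t) = t := by
  have hlt := hl.lowStrand_lt_highStrand t
  apply le_antisymm
  · by_contra h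
    have := (height_lt_iff_le_crossTime hl hlt (t := t + 1) (by omega)).2 (by omega)
    rw [height_succ_low, height_succ_high, Fin.lt_def, height_highStrand_val] at this
    omega
  · rw [← height_lt_iff_le_crossTime hl hlt t.2.le, Fin.lt_def, height_highStrand_val]
    omega

theorem crossTime_inj {a b c d : Fin (n + 1)} (hab : a < b) (hcd : c < d)
    (h : crossTime l a b = crossTime l c d) : a = c ∧ b = d := by
  have h1 := strands_crossTime hl hab
  have h2 := strands_crossTime hl hcd
  simp only [h] at h1
  exact ⟨h1.1.symm.trans h2.1, h1.2.symm.trans h2.2⟩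

omit hl in
/-- No strand is between the two strands of a crossing. -/
theorem height_lt_lowStrand_iff (t : Fin l.length) {y : Fin (n + 1)} (h₁ : y ≠ lowStrand l t) :
    height l t y < height l t (lowStrand l t) ↔ height l t y < height l t (highStrand l t) := by
  have hh := height_highStrand_val t
  have : (height l t y : ℕ) ≠ height l t (lowStrand l t) := fun e =>
    h₁ (height_injective l t (Fin.ext e))
  rw [Fin.lt_def, Fin.lt_def]
  omega

/-- The three crossings of three strands occur in lexicographic or in antilexicographic order. -/
theorem crossTime_triple {a b c : Fin (n + 1)} (hab : a < b) (hbc : b < c) :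
    (crossTime l a b < crossTime l a c ∧ crossTime l a c < crossTime l b c) ∨
    (crossTime l b c < crossTime l a c ∧ crossTime l a c < crossTime l a b) := by
  have hac := hab.trans hbc
  have n1 : crossTime l a b ≠ crossTime l a c := fun e => hbc.ne (crossTime_inj hl hab hac e).2
  have n2 : crossTime l a c ≠ crossTime l b c := fun e => hab.ne (crossTime_inj hl hac hbc e).1
  have n3 : crossTime l a b ≠ crossTime l b c := fun e => hab.ne (crossTime_inj hl hab hbc e).1
  have k1 : crossTime l b c ≤ crossTime l a b ↔ crossTime l b c ≤ crossTime l a c := by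
    have ht := crossTime_lt_length hl hbc
    obtain ⟨e1, e2⟩ := strands_crossTime hl hbc
    have := height_lt_lowStrand_iff ⟨_, ht⟩ (y := a) (by rw [e1]; exact hab.ne)
    rw [e1, e2] at this
    rwa [height_lt_iff_le_crossTime hl hab ht.le, height_lt_iff_le_crossTime hl hac ht.le] at this
  have k2 : crossTime l a b ≤ crossTime l a c ↔ crossTime l a b ≤ crossTime l b c := by
    have ht := crossTime_lt_length hl hab
    obtain ⟨e1, e2⟩ := strands_crossTime hl hab
    have := height_lt_lowStrand_iff ⟨_, ht⟩ (y := c) (by rw [e1]; exact hac.ne')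
    rw [e1, e2] at this
    have f1 := height_lt_iff_le_crossTime hl hac ht.le
    have f2 := height_lt_iff_le_crossTime hl hbc ht.le
    have i1 : height l (crossTime l a b) c ≠ height l (crossTime l a b) a := fun e =>
      hac.ne' (height_injective l _ e)
    have i2 : height l (crossTime l a b) c ≠ height l (crossTime l a b) b := fun e =>
      hbc.ne' (height_injective l _ e)
    rw [← f1, ← f2, ← not_iff_not, not_lt, not_lt, i1.le_iff_lt, i2.le_iff_lt]
    exact this
  omega

end CrossTime

/-! ### Comparable crossings -/

section Comparable

variable {n : ℕ} {l : List (Fin n)}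

theorem height_eq_of_forall_ne {y : Fin (n + 1)} {s t : ℕ} (hst : s ≤ t) (ht : t ≤ l.length)
    (h : ∀ v : Fin l.length, s ≤ v → v < t → y ≠ lowStrand l v ∧ y ≠ highStrand l v) :
    height l t y = height l s y := by
  induction t, hst using Nat.le_induction with
  | base => rfl
  | succ t hst ih =>
    have h1 := h ⟨t, ht⟩ hst (Nat.lt_succ_self t)
    rw [← ih (by omega) fun v hv hv' => h v hv (by omega)]
    exact height_succ_of_ne ⟨t, ht⟩ h1.1 h1.2

theorem strandAt_eq_of_forall_ne {p : Fin (n + 1)} {s t : ℕ} (hst : s ≤ t) (ht : t ≤ l.length)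
    (h : ∀ v : Fin l.length, s ≤ v → v < t → p ≠ (l.get v).castSucc ∧ p ≠ (l.get v).succ) :
    strandAt l t p = strandAt l s p := by
  induction t, hst using Nat.le_induction with
  | base => rfl
  | succ t hst ih =>
    have h1 := h ⟨t, ht⟩ hst (Nat.lt_succ_self t)
    rw [← ih (by omega) fun v hv hv' => h v hv (by omega)]
    refine (congrArg (· p) (strandAt_succ ⟨t, ht⟩)).trans ?_
    rw [Equiv.Perm.mul_apply, simpleTransposition, Equiv.swap_apply_of_ne_of_ne h1.1 h1.2]

theorem val_eq_iff_strand {t : Fin l.length} {y : Fin (n + 1)} :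
    (y = lowStrand l t ↔ (height l t y : ℕ) = l.get t) ∧
    (y = highStrand l t ↔ (height l t y : ℕ) = l.get t + 1) := by
  constructor
  · rw [← (height_injective l t).eq_iff, height_lowStrand, Fin.ext_iff]; rfl
  · rw [← (height_injective l t).eq_iff, height_highStrand, Fin.ext_iff]; rfl

variable (hl : IsReducedWord (longestElement n) l)
include hl

/-- Consecutive crossings on a strand are comparable: they lie in adjacent columns, or in the same
column, and then there is a crossing in an adjacent column between them, as the two strands of
the first crossing do not cross again. -/
theorem wordRel_of_consecutive {y : Fin (n + 1)} {u r : Fin l.length} (hur : u < r)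
    (hu : y = lowStrand l u ∨ y = highStrand l u) (hr : y = lowStrand l r ∨ y = highStrand l r)
    (h : ∀ v : Fin l.length, u < v → v < r → y ≠ lowStrand l v ∧ y ≠ highStrand l v) :
    Relation.ReflTransGen (wordRel l) u r := by
  have hy : ∀ v : Fin l.length, u < v → v ≤ r → height l v y = height l (u + 1) y :=
    fun v huv hvr => height_eq_of_forall_ne huv v.2.le fun w hw hw' => h w hw (by omega)
  have hu' : (height l (u + 1) y : ℕ) = l.get u ∨ (height l (u + 1) y : ℕ) = l.get u + 1 := by
    rcases hu with rfl | rfl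
    · right; rw [height_succ_low, height_highStrand]; rfl
    · left; rw [height_succ_high, height_lowStrand]; rfl
  rw [val_eq_iff_strand.1, val_eq_iff_strand.2, hy r hur le_rfl] at hr
  by_cases hadj : |((l.get u : ℕ) : ℤ) - ((l.get r : ℕ) : ℤ)| = 1
  · exact .single ⟨hur, hadj⟩
  have hsame : (l.get u : ℕ) = l.get r := by
    rcases hu' with hu' | hu' <;> rcases hr with hr | hr
    · omega
    · exact absurd (abs_eq (zero_le_one) |>.2 (by omega)) hadj
    · exact absurd (abs_eq (zero_le_one) |>.2 (by omega)) hadj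
    · omega
  by_cases hex : ∃ v : Fin l.length, u < v ∧ v < r ∧
      |((l.get u : ℕ) : ℤ) - ((l.get v : ℕ) : ℤ)| = 1
  · obtain ⟨v, h1, h2, h3⟩ := hex
    exact .tail (.single ⟨h1, h3⟩) ⟨h2, by rw [← hsame, abs_sub_comm]; exact h3⟩
  exfalso
  push Not at hex
  have hv : ∀ v : Fin l.length, u < v → v < r →
      (l.get v : ℕ) ≠ l.get u ∧ (l.get v : ℕ) + 1 ≠ l.get u ∧ (l.get v : ℕ) ≠ l.get u + 1 := by
    intro v h1 h2
    have h3 := hex v h1 h2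
    have h4 := h v h1 h2
    rw [Ne, Ne, val_eq_iff_strand.1, val_eq_iff_strand.2, hy v h1 h2.le] at h4
    refine ⟨by omega, fun e => h3 ?_, fun e => h3 ?_⟩
    · exact abs_eq (zero_le_one) |>.2 (by omega)
    · exact abs_eq (zero_le_one) |>.2 (by omega)
  have e : l.get u = l.get r := Fin.ext hsame
  have e1 : lowStrand l r = highStrand l u := by
    rw [lowStrand, ← e, strandAt_eq_of_forall_ne (Nat.succ_le_of_lt hur) r.2.le fun v h1 h2 => ?_,
      strandAt_succ, simpleTransposition]
    · simp [highStrand]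
    · have := hv v h1 h2
      simp only [ne_eq, Fin.ext_iff, Fin.val_castSucc, Fin.val_succ]
      omega
  have e2 : highStrand l r = lowStrand l u := by
    rw [highStrand, ← e, strandAt_eq_of_forall_ne (Nat.succ_le_of_lt hur) r.2.le fun v h1 h2 => ?_,
      strandAt_succ, simpleTransposition]
    · simp [lowStrand]
    · have := hv v h1 h2
      simp only [ne_eq, Fin.ext_iff, Fin.val_castSucc, Fin.val_succ]
      omega
  have h1 := hl.lowStrand_lt_highStrand r
  rw [e1, e2] at h1
  exact absurd h1 (hl.lowStrand_lt_highStrand u).asymm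

/-- Two crossings on the same strand are comparable. -/
theorem reflTransGen_of_common_strand {y : Fin (n + 1)} {s t : Fin l.length} (hst : s < t)
    (hs : y = lowStrand l s ∨ y = highStrand l s) (ht : y = lowStrand l t ∨ y = highStrand l t) :
    Relation.ReflTransGen (wordRel l) s t := by
  suffices H : ∀ r : ℕ, s + 1 ≤ r → r ≤ l.length → ∃ u : Fin l.length, (u : ℕ) < r ∧
      Relation.ReflTransGen (wordRel l) s u ∧ (y = lowStrand l u ∨ y = highStrand l u) ∧
      ∀ v : Fin l.length, u < v → v < r → y ≠ lowStrand l v ∧ y ≠ highStrand l v by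
    obtain ⟨u, h1, h2, h3, h4⟩ := H t hst t.2.le
    exact h2.trans (wordRel_of_consecutive hl h1 h3 ht h4)
  intro r hr
  induction r, hr using Nat.le_induction with
  | base => exact fun _ => ⟨s, by omega, .refl, hs, fun v h1 h2 => by omega⟩
  | succ r hr ih =>
    intro hrl
    obtain ⟨u, h1, h2, h3, h4⟩ := ih (by omega)
    by_cases hy : y = lowStrand l ⟨r, hrl⟩ ∨ y = highStrand l ⟨r, hrl⟩
    · exact ⟨⟨r, hrl⟩, by simp, h2.trans (wordRel_of_consecutive hl h1 h3 hy h4), hy,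
        fun v h5 h6 => by rw [Fin.lt_def] at h5; simp only at h5; omega⟩
    · refine ⟨u, by omega, h2, h3, fun v h5 h6 => ?_⟩
      rcases Nat.lt_succ_iff_lt_or_eq.1 h6 with h7 | h7
      · exact h4 v h5 h7
      · obtain rfl : v = ⟨r, hrl⟩ := Fin.ext h7
        exact not_or.1 hy

end Comparable

/-! ### The sub-arrangement on a set of strands -/

/-- The number of strands of `W` below the strand `y`, just before the letter number `t`. -/
def relHeight {n : ℕ} (l : List (Fin n)) (W : Finset (Fin (n + 1))) (t : ℕ) (y : Fin (n + 1)) : ℕ :=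
  {k ∈ W | height l t k < height l t y}.card

/-- Both strands of the crossing number `t` belong to `W`. -/
def IsCrossingOf {n : ℕ} (l : List (Fin n)) (W : Finset (Fin (n + 1))) (t : Fin l.length) : Prop :=
  lowStrand l t ∈ W ∧ highStrand l t ∈ W

section RelHeight

variable {n : ℕ} {l : List (Fin n)} {W : Finset (Fin (n + 1))}

theorem relHeight_lt_iff {t : ℕ} {y z : Fin (n + 1)} (hy : y ∈ W) :
    relHeight l W t y < relHeight l W t z ↔ height l t y < height l t z := by
  constructor
  · intro h
    by_contra h'
    refine absurd h (not_lt.2 (Finset.card_le_card fun k hk => ?_))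
    simp only [Finset.mem_filter] at hk ⊢
    exact ⟨hk.1, hk.2.trans_le (not_lt.1 h')⟩
  · intro h
    refine Finset.card_lt_card (Finset.ssubset_iff_of_subset (fun k hk => ?_) |>.2 ⟨y, ?_, ?_⟩)
    · simp only [Finset.mem_filter] at hk ⊢
      exact ⟨hk.1, hk.2.trans h⟩
    · simpa [hy] using h
    · simp

theorem relHeight_injOn {t : ℕ} {y z : Fin (n + 1)} (hy : y ∈ W) (hz : z ∈ W)
    (h : relHeight l W t y = relHeight l W t z) : y = z := by
  by_contra hne
  rcases lt_or_gt_of_ne fun e => hne (height_injective l t e) with h1 | h1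
  · exact absurd ((relHeight_lt_iff hy).2 h1) (by omega)
  · exact absurd ((relHeight_lt_iff hz).2 h1) (by omega)

theorem relHeight_lt_card {t : ℕ} {y : Fin (n + 1)} (hy : y ∈ W) :
    relHeight l W t y < W.card :=
  Finset.card_lt_card (Finset.ssubset_iff_of_subset (Finset.filter_subset _ _) |>.2
    ⟨y, hy, by simp⟩)

theorem relHeight_highStrand {t : Fin l.length} (ht : IsCrossingOf l W t) :
    relHeight l W t (highStrand l t) = relHeight l W t (lowStrand l t) + 1 := by
  rw [relHeight, relHeight, ← Finset.card_insert_of_notMem (a := lowStrand l t) (by simp)]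
  congr 1
  ext k
  simp only [Finset.mem_filter, Finset.mem_insert]
  by_cases hk : k = lowStrand l t
  · subst hk
    simp [ht.1, Fin.lt_def, height_highStrand_val]
  · have : (height l t k : ℕ) ≠ height l t (lowStrand l t) := fun e =>
      hk (height_injective l t (Fin.ext e))
    simp only [hk, false_or, Fin.lt_def, height_highStrand_val]
    exact and_congr_right fun _ => by omega

/-- A strand keeps its height in the arrangement on `W` as long as it does not meet a strand
of `W`. -/
theorem relHeight_succ_of_ne {t : Fin l.length} {y : Fin (n + 1)} (hy : y ∈ W)
    (h : IsCrossingOf l W t → y ≠ lowStrand l t ∧ y ≠ highStrand l t) :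
    relHeight l W (t + 1) y = relHeight l W t y := by
  rw [relHeight, relHeight]
  congr 1
  refine Finset.filter_congr fun k hk => ?_
  have hne : k ≠ y → height l t k ≠ height l t y ∧ height l (t + 1) k ≠ height l (t + 1) y :=
    fun hne => ⟨fun e => hne (height_injective l _ e), fun e => hne (height_injective l _ e)⟩
  by_cases hky : k = y
  · subst hky; simp
  have hne := hne hky
  constructor
  · intro h1
    by_contra h2
    obtain ⟨e1, e2⟩ := eq_strands_of_height_lt t (lt_of_le_of_ne (not_lt.1 h2) hne.1.symm) h1
    exact (h ⟨e1 ▸ hy, e2 ▸ hk⟩).1 e1.symm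
  · intro h1
    by_contra h2
    obtain ⟨e1, e2⟩ := eq_strands_of_height_lt t h1 (lt_of_le_of_ne (not_lt.1 h2) hne.2.symm)
    exact (h ⟨e1 ▸ hk, e2 ▸ hy⟩).2 e2.symm

/-- A crossing of the arrangement on `W` exchanges the heights of its strands. -/
theorem relHeight_succ_of_crossing {t : Fin l.length} (ht : IsCrossingOf l W t) (y : Fin (n + 1)) :
    relHeight l W (t + 1) y =
      relHeight l W t (Equiv.swap (lowStrand l t) (highStrand l t) y) := by
  have hW : ∀ k ∈ W, Equiv.swap (lowStrand l t) (highStrand l t) k ∈ W := by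
    intro k hk
    by_cases h1 : k = lowStrand l t
    · rw [h1, Equiv.swap_apply_left]; exact ht.2
    by_cases h2 : k = highStrand l t
    · rw [h2, Equiv.swap_apply_right]; exact ht.1
    rwa [Equiv.swap_apply_of_ne_of_ne h1 h2]
  refine Finset.card_bij (fun k _ => Equiv.swap (lowStrand l t) (highStrand l t) k) ?_ ?_ ?_
  · intro k hk
    simp only [Finset.mem_filter] at hk ⊢
    rw [height_succ, height_succ] at hk
    exact ⟨hW k hk.1, hk.2⟩
  · intro a _ b _ h; exact (Equiv.swap _ _).injective h
  · intro k hk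
    simp only [Finset.mem_filter] at hk
    refine ⟨Equiv.swap (lowStrand l t) (highStrand l t) k, ?_, Equiv.swap_apply_self _ _ _⟩
    simp only [Finset.mem_filter, height_succ, Equiv.swap_apply_self]
    exact ⟨hW k hk.1, hk.2⟩

theorem relHeight_succ_low {t : Fin l.length} (ht : IsCrossingOf l W t) :
    relHeight l W (t + 1) (lowStrand l t) = relHeight l W t (lowStrand l t) + 1 := by
  rw [relHeight_succ_of_crossing ht, Equiv.swap_apply_left, relHeight_highStrand ht]

theorem relHeight_succ_high {t : Fin l.length} (ht : IsCrossingOf l W t) :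
    relHeight l W (t + 1) (highStrand l t) = relHeight l W t (lowStrand l t) := by
  rw [relHeight_succ_of_crossing ht, Equiv.swap_apply_right]

theorem relHeight_erase {e : Fin (n + 1)} (he : e ∈ W) (t : ℕ) (y : Fin (n + 1)) :
    relHeight l W t y =
      relHeight l (W.erase e) t y + if height l t e < height l t y then 1 else 0 := by
  rw [relHeight, ← Finset.insert_erase he, Finset.filter_insert, relHeight]
  simp only [Finset.erase_insert_eq_erase, Finset.erase_idem]
  split_ifs with h
  · rw [Finset.card_insert_of_notMem (by simp)]
  · rfl

/-- Crossings in the same column of the arrangement on `W` are comparable. The strands that are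
found in the lower of the two heights concerned, after the first of these crossings, have all met
a crossing above it: every change of strand is itself a crossing on the preceding strand. -/
theorem reflTransGen_of_relHeight_eq (hl : IsReducedWord (longestElement n) l) {s t : Fin l.length}
    (hst : s < t) (hs : IsCrossingOf l W s) (ht : IsCrossingOf l W t)
    (h : relHeight l W s (lowStrand l s) = relHeight l W t (lowStrand l t)) :
    Relation.ReflTransGen (wordRel l) s t := by
  suffices H : ∀ r : ℕ, s + 1 ≤ r → r ≤ l.length → ∃ u : Fin l.length, ∃ y ∈ W, (u : ℕ) < r ∧
      Relation.ReflTransGen (wordRel l) s u ∧ (y = lowStrand l u ∨ y = highStrand l u) ∧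
      relHeight l W r y = relHeight l W s (lowStrand l s) by
    obtain ⟨u, y, hy, h1, h2, h3, h4⟩ := H t hst t.2.le
    obtain rfl := relHeight_injOn hy ht.1 (h4.trans h)
    exact h2.trans (reflTransGen_of_common_strand hl h1 h3 (.inl rfl))
  intro r hr
  induction r, hr using Nat.le_induction with
  | base => exact fun _ => ⟨s, highStrand l s, hs.2, by omega, .refl, .inr rfl,
      relHeight_succ_high hs⟩
  | succ r hr ih =>
    intro hrl
    obtain ⟨u, y, hy, h1, h2, h3, h4⟩ := ih (by omega)
    obtain ⟨q, rfl⟩ : ∃ q : Fin l.length, (q : ℕ) = r := ⟨⟨r, hrl⟩, rfl⟩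
    by_cases hc : IsCrossingOf l W q ∧ (y = lowStrand l q ∨ y = highStrand l q)
    · have h5 := h2.trans (reflTransGen_of_common_strand hl h1 h3 hc.2)
      rcases hc.2 with h7 | h7
      · refine ⟨q, highStrand l q, hc.1.2, Nat.lt_succ_self _, h5, .inr rfl, ?_⟩
        rw [← h4, h7, relHeight_succ_high hc.1]
      · refine ⟨q, lowStrand l q, hc.1.1, Nat.lt_succ_self _, h5, .inl rfl, ?_⟩
        rw [← h4, h7, relHeight_succ_low hc.1, relHeight_highStrand hc.1]
    · refine ⟨u, y, hy, by omega, h2, h3, ?_⟩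
      rw [← h4]
      exact relHeight_succ_of_ne hy fun hX => not_or.1 fun e => hc ⟨hX, e⟩

end RelHeight

/-! ### The climb of an extreme strand -/

/-- The climb of a particle on the heights `0, …, m`: before time `t` it is at height `h t`; at the
time `t` of an event (`X t`) something moves from height `g t` to height `g t + 1` and something
else back. The particle follows the events that start at its height, and it is never pushed down
by an event. -/
structure IsClimb (L m : ℕ) (h : ℕ → ℕ) (g : Fin L → ℕ) (X : Fin L → Prop) : Prop where
  start : h 0 = 0
  finish : h L = m
  lt : ∀ t, X t → g t < m
  ne : ∀ t, X t → h t ≠ g t + 1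
  move : ∀ t, X t → h t = g t → h (t + 1) = h t + 1
  stay : ∀ t : Fin L, ¬ (X t ∧ h t = g t) → h (t + 1) = h t

namespace IsClimb

variable {L m : ℕ} {h : ℕ → ℕ} {g : Fin L → ℕ} {X : Fin L → Prop} (H : IsClimb L m h g X)
include H

theorem mono {s t : ℕ} (hst : s ≤ t) (ht : t ≤ L) : h s ≤ h t := by
  induction t, hst using Nat.le_induction with
  | base => rfl
  | succ t hst ih =>
    refine (ih (by omega)).trans ?_
    by_cases hc : X ⟨t, ht⟩ ∧ h t = g ⟨t, ht⟩
    · have := H.move ⟨t, ht⟩ hc.1 hc.2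
      simp only at this; omega
    · exact (H.stay ⟨t, ht⟩ hc).ge

/-- A sequence of events that starts at the bottom, each event one level above the preceding one,
consists of steps of the particle: the particle is never below it, and once above it stays so, as
it cannot be pushed down; but the sequence ends at the top. -/
theorem eq_of_strictMono {c : Fin m → Fin L} (hc : StrictMono c) (hX : ∀ i, X (c i))
    (hg : ∀ i, g (c i) = i) (i : Fin m) : h (c i) = i := by
  have hstep : ∀ (i : ℕ) (h1 : i + 1 < m), h (c ⟨i, by omega⟩ + 1) ≤ h (c ⟨i + 1, h1⟩) := by
    intro i h1
    exact H.mono (Nat.succ_le_of_lt (hc (by simp [Fin.lt_def]))) (c _).2.le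
  have ge : ∀ (i : ℕ) (hi : i < m), i ≤ h (c ⟨i, hi⟩) := by
    intro i
    induction i with
    | zero => exact fun _ => Nat.zero_le _
    | succ i ih =>
      intro hi
      have h1 := ih (by omega)
      have h2 := hstep i hi
      have h3 := hg ⟨i, by omega⟩
      have h5 := H.mono (Nat.le_add_right (c ⟨i, by omega⟩ : ℕ) 1) (c ⟨i, by omega⟩).2
      by_cases e : h (c ⟨i, by omega⟩) = i
      · have h4 := H.move _ (hX ⟨i, by omega⟩) (e.trans h3.symm)
        omega
      · omega
  have stays : ∀ (j : ℕ) (i : ℕ) (hij : i + j < m), i < h (c ⟨i, by omega⟩) →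
      i + j < h (c ⟨i + j, hij⟩) := by
    intro j
    induction j with
    | zero => exact fun i _ hi => hi
    | succ j ih =>
      intro i hij hi
      have h1 := ih i (by omega) hi
      have h2 := hstep (i + j) hij
      have h3 := H.ne _ (hX ⟨i + j, by omega⟩)
      have h4 := hg ⟨i + j, by omega⟩
      have h5 := H.mono (Nat.le_add_right (c ⟨i + j, by omega⟩ : ℕ) 1) (c ⟨i + j, by omega⟩).2
      simp only at h4
      change i + j + 1 < h (c ⟨i + j + 1, hij⟩)
      omega
  by_contra hne
  have h1 := ge i i.2
  have hi := i.2
  have h2 := stays (m - 1 - i) i (by omega) (lt_of_le_of_ne h1 (Ne.symm hne))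
  have h3 := H.ne _ (hX ⟨i + (m - 1 - i), by omega⟩)
  have h4 := hg ⟨i + (m - 1 - i), by omega⟩
  have h5 := H.mono (c ⟨i + (m - 1 - i), by omega⟩).2.le le_rfl
  have h6 := H.finish
  simp only at h4
  omega

theorem exists_step {i : ℕ} (hi : i < m) : ∃ t, X t ∧ h t = i ∧ g t = i := by
  by_contra hno
  push Not at hno
  have : ∀ t ≤ L, h t ≤ i := by
    intro t
    induction t with
    | zero => exact fun _ => H.start.le.trans (Nat.zero_le _)
    | succ t ih =>
      intro ht
      have h1 := ih (by omega)
      by_cases hc : X ⟨t, ht⟩ ∧ h t = g ⟨t, ht⟩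
      · have h2 := H.move ⟨t, ht⟩ hc.1 hc.2
        have h3 := hno ⟨t, ht⟩ hc.1
        have h4 := hc.2
        simp only at h2 h3
        omega
      · exact (H.stay ⟨t, ht⟩ hc).le.trans h1
  have := this L le_rfl
  rw [H.finish] at this
  omega

theorem lt_iff {x t : Fin L} (hx : X x) (hxg : h x = g x) :
    x < t ↔ g x < h t := by
  have h1 := H.move x hx hxg
  constructor
  · intro hlt
    have : h (x + 1) ≤ h t := H.mono (Nat.succ_le_of_lt hlt) t.2.le
    omega
  · intro hgt
    by_contra hle
    have := H.mono (not_lt.1 hle) x.2.le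
    omega

theorem eq_of_eq {x t : Fin L} (hx : X x) (hxg : h x = g x) (ht : X t) (htg : h t = g t)
    (hxt : g x = g t) : x = t :=
  le_antisymm (not_lt.1 fun hlt => by have := (H.lt_iff ht htg).1 hlt; omega)
    (not_lt.1 fun hlt => by have := (H.lt_iff hx hxg).1 hlt; omega)

end IsClimb

/-! ### Sub-arrangements as word posets, and the climb of their extreme strands -/

/-- The crossings of the arrangement on the set `W` of strands, with the order induced from the
word poset of `l` and the columns of the arrangement on `W`. -/
def subPoset {n : ℕ} (l : List (Fin n)) (W : Finset (Fin (n + 1))) : WordPoset.{0} where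
  carrier := {t : Fin l.length // IsCrossingOf l W t}
  order := inferInstanceAs (PartialOrder {t : wordPoset l // IsCrossingOf l W t})
  col := fun t => Nat.succPNat (relHeight l W t.1 (lowStrand l t.1))

/-- The extreme strand of `W` that generates the directed chain: the smallest strand for the
ascending chain, the greatest for the descending one. -/
def IsExtremeStrand {n : ℕ} (W : Finset (Fin (n + 1))) : Direction → Fin (n + 1) → Prop
  | .A, e => e ∈ W ∧ ∀ k ∈ W, e ≤ k
  | .D, e => e ∈ W ∧ ∀ k ∈ W, k ≤ e

/-- The strand which moves at the crossing `t` in the direction of the chain: the one going up for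
ascending chains, the one going down for descending chains. -/
def leadStrand {n : ℕ} (l : List (Fin n)) : Direction → Fin l.length → Fin (n + 1)
  | .A, t => lowStrand l t
  | .D, t => highStrand l t

/-- The number of strands of `W` passed by a strand that started at the bottom (for `A`) or at the
top (for `D`), where `m + 1` is the number of strands of `W`. -/
def progress {n : ℕ} (l : List (Fin n)) (W : Finset (Fin (n + 1))) (m : ℕ) :
    Direction → ℕ → Fin (n + 1) → ℕ
  | .A, t, y => relHeight l W t y
  | .D, t, y => m - relHeight l W t y

section Climb

variable {n : ℕ} {l : List (Fin n)} {W : Finset (Fin (n + 1))} {m : ℕ} {e : Fin (n + 1)}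
  {ε : Direction}

theorem IsExtremeStrand.mem (he : IsExtremeStrand W ε e) : e ∈ W := by
  cases ε <;> exact he.1

theorem leadStrand_mem {t : Fin l.length} (ht : IsCrossingOf l W t) : leadStrand l ε t ∈ W := by
  cases ε
  · exact ht.1
  · exact ht.2

theorem progress_injOn (hm : W.card = m + 1) {t : ℕ} {y z : Fin (n + 1)} (hy : y ∈ W) (hz : z ∈ W)
    (h : progress l W m ε t y = progress l W m ε t z) : y = z := by
  have h1 := relHeight_lt_card (l := l) (t := t) hy
  have h2 := relHeight_lt_card (l := l) (t := t) hz
  cases ε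
  · exact relHeight_injOn hy hz h
  · apply relHeight_injOn hy hz (l := l) (t := t)
    simp only [progress] at h
    omega

theorem relHeight_eq_zero {t : ℕ} (h : ∀ k ∈ W, height l t e ≤ height l t k) :
    relHeight l W t e = 0 := by
  rw [relHeight, Finset.card_eq_zero, Finset.filter_eq_empty_iff]
  exact fun k hk => not_lt.2 (h k hk)

theorem relHeight_eq_card_sub_one (he : e ∈ W) {t : ℕ}
    (h : ∀ k ∈ W, height l t k ≤ height l t e) : relHeight l W t e = W.card - 1 := by
  rw [relHeight, ← Finset.card_erase_of_mem he]
  congr 1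
  ext k
  simp only [Finset.mem_filter, Finset.mem_erase]
  constructor
  · rintro ⟨h1, h2⟩
    exact ⟨by rintro rfl; exact lt_irrefl _ h2, h1⟩
  · rintro ⟨h1, h2⟩
    exact ⟨h2, lt_of_le_of_ne (h k h2) fun h3 => h1 (height_injective l t h3)⟩

variable (hl : IsReducedWord (longestElement n) l) (hm : W.card = m + 1)
  (he : IsExtremeStrand W ε e)
include hl hm he

theorem isClimb_progress : IsClimb l.length m (fun t => progress l W m ε t e)
    (fun t => progress l W m ε t (leadStrand l ε t)) (IsCrossingOf l W) := by
  have hle : ∀ t, ∀ y ∈ W, relHeight l W t y ≤ m := fun t y hy => by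
    have := relHeight_lt_card (l := l) (t := t) hy; omega
  cases ε
  · refine ⟨?_, ?_, ?_, ?_, ?_, ?_⟩
    · exact relHeight_eq_zero fun k hk => by simpa [height_zero] using he.2 k hk
    · have := relHeight_eq_card_sub_one (l := l) (t := l.length) he.1 fun k hk => by
        simpa [height_length hl] using he.2 k hk
      simp only [progress]; omega
    · intro t ht
      have h1 := hle t _ ht.2
      rw [relHeight_highStrand ht] at h1
      simp only [progress, leadStrand]; omega
    · intro t ht h
      simp only [progress, leadStrand] at h
      rw [← relHeight_highStrand ht] at h
      have := relHeight_injOn he.1 ht.2 h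
      exact absurd (hl.lowStrand_lt_highStrand t) (not_lt.2 (this ▸ he.2 _ ht.1))
    · intro t ht h
      obtain rfl := relHeight_injOn he.1 ht.1 h
      exact relHeight_succ_low ht
    · intro t h
      refine relHeight_succ_of_ne he.1 fun ht => ⟨?_, ?_⟩
      · rintro rfl; exact h ⟨ht, rfl⟩
      · intro h1
        exact absurd (hl.lowStrand_lt_highStrand t) (not_lt.2 (h1 ▸ he.2 _ ht.1))
  · refine ⟨?_, ?_, ?_, ?_, ?_, ?_⟩
    · have := relHeight_eq_card_sub_one (l := l) (t := 0) he.1 fun k hk => by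
        simpa [height_zero] using he.2 k hk
      simp only [progress]; omega
    · simp only [progress]
      rw [relHeight_eq_zero fun k hk => by simpa [height_length hl] using he.2 k hk, Nat.sub_zero]
    · intro t ht
      have h1 := hle t _ ht.2
      have h2 := relHeight_highStrand ht
      simp only [progress, leadStrand]; omega
    · intro t ht h
      have h1 := hle t _ ht.2
      have h2 := relHeight_highStrand ht
      have h3 := hle t _ he.1
      simp only [progress, leadStrand] at h
      have := relHeight_injOn (l := l) (t := t) he.1 ht.1 (by omega)
      exact absurd (hl.lowStrand_lt_highStrand t) (not_lt.2 (this ▸ he.2 _ ht.2))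
    · intro t ht h
      obtain rfl := progress_injOn hm he.1 ht.2 h
      have h1 := hle t _ ht.2
      have h2 := relHeight_highStrand ht
      have h3 := relHeight_succ_high ht
      simp only [progress]; omega
    · intro t h
      simp only [progress]
      rw [relHeight_succ_of_ne he.1 fun ht => ⟨?_, ?_⟩]
      · intro h1
        exact absurd (hl.lowStrand_lt_highStrand t) (not_lt.2 (h1 ▸ he.2 _ ht.2))
      · rintro rfl; exact h ⟨ht, rfl⟩

omit hl he in
/-- A directed chain is given by its columns, expressed through the progress of the lead
strands. -/
theorem isDirectedChain_subPoset_iff (c : Fin m → subPoset l W) :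
    (subPoset l W).IsDirectedChain m ε c ↔ StrictMono c ∧
      ∀ i, progress l W m ε (c i).1 (leadStrand l ε (c i).1) = i := by
  cases ε
  · refine and_congr_right fun _ => forall_congr' fun i => ?_
    change relHeight l W _ _ + 1 = (i : ℕ) + 1 ↔ _
    simp only [progress, leadStrand]
    omega
  · refine and_congr_right fun _ => forall_congr' fun i => ?_
    have h1 := relHeight_lt_card (l := l) (t := (c i).1) (c i).2.2
    have h2 := relHeight_highStrand (c i).2
    have h3 := i.2
    change relHeight l W _ _ + 1 = m - (i : ℕ) ↔ _
    simp only [progress, leadStrand]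
    omega

omit hl in
theorem leadStrand_eq_iff {t : Fin l.length} (ht : IsCrossingOf l W t) : leadStrand l ε t = e ↔
    progress l W m ε t e = progress l W m ε t (leadStrand l ε t) :=
  ⟨fun h => by rw [h], fun h => (progress_injOn hm he.mem (leadStrand_mem ht) h).symm⟩

omit hl hm he in
theorem subPoset_lt_iff {x y : subPoset l W} : x < y ↔
    Relation.ReflTransGen (wordRel l) x.1 y.1 ∧ x.1 < y.1 := by
  change Relation.ReflTransGen (wordRel l) x.1 y.1 ∧ ¬ Relation.ReflTransGen (wordRel l) y.1 x.1 ↔ _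
  refine and_congr_right fun h => ?_
  have h1 := le_of_reflTransGen_wordRel l h
  constructor
  · intro h2
    exact lt_of_le_of_ne h1 fun e => h2 (e ▸ .refl)
  · exact fun h2 h3 => absurd (le_of_reflTransGen_wordRel l h3) (not_le.2 h2)

omit hl he in
theorem col_eq_iff_progress_eq {x y : subPoset l W} : (subPoset l W).col x = (subPoset l W).col y ↔
    progress l W m ε x.1 (leadStrand l ε x.1) = progress l W m ε y.1 (leadStrand l ε y.1) := by
  change Nat.succPNat _ = Nat.succPNat _ ↔ _
  rw [Nat.succPNat_inj]
  have h1 := relHeight_highStrand x.2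
  have h2 := relHeight_highStrand y.2
  have h3 := relHeight_lt_card (l := l) (t := x.1) x.2.2
  have h4 := relHeight_lt_card (l := l) (t := y.1) y.2.2
  cases ε <;> simp only [progress, leadStrand]
  omega

/-- The ascending (descending) chain consists of the crossings of the smallest (greatest)
strand. -/
theorem directedChain_subPoset :
    (subPoset l W).directedChain m ε = {t | leadStrand l ε t.1 = e} := by
  have H := isClimb_progress hl hm he
  ext t
  constructor
  · rintro ⟨c, hc, i, rfl⟩
    rw [isDirectedChain_subPoset_iff hm] at hc
    refine (leadStrand_eq_iff hm he (c i).2).2 ?_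
    rw [hc.2 i]
    exact H.eq_of_strictMono (c := fun i => (c i).1)
      (fun i j hij => (subPoset_lt_iff.1 (hc.1 hij)).2) (fun i => (c i).2) hc.2 i
  · intro ht
    choose c hX hh hg using fun i : Fin m => H.exists_step i.2
    have hlead : ∀ i, leadStrand l ε (c i) = e := fun i =>
      (leadStrand_eq_iff hm he (hX i)).2 ((hh i).trans (hg i).symm)
    have hmono : StrictMono c := fun i j hij =>
      (H.lt_iff (hX i) ((hh i).trans (hg i).symm)).2 (by rw [hg i, hh j]; exact hij)
    have hshare : ∀ t : Fin l.length, leadStrand l ε t = e →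
        e = lowStrand l t ∨ e = highStrand l t := by
      intro t ht
      cases ε
      · exact .inl ht.symm
      · exact .inr ht.symm
    refine ⟨fun i => ⟨c i, hX i⟩, (isDirectedChain_subPoset_iff hm _).2 ⟨?_, hg⟩, ?_⟩
    · intro i j hij
      exact subPoset_lt_iff.2 ⟨reflTransGen_of_common_strand hl (hmono hij) (hshare _ (hlead i))
        (hshare _ (hlead j)), hmono hij⟩
    · have ht' := (leadStrand_eq_iff hm he t.2).1 ht
      exact ⟨⟨_, H.lt _ t.2⟩, Subtype.ext
        (H.eq_of_eq (hX _) ((hh _).trans (hg _).symm) t.2 ht' (hg _))⟩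

/-- The crossings above the chain are those which the extreme strand has passed. -/
theorem above_chain_iff (k : subPoset l W) :
    (∃ x ∈ (subPoset l W).directedChain m ε, x < k ∧ (subPoset l W).col k = (subPoset l W).col x) ↔
      progress l W m ε k.1 (leadStrand l ε k.1) < progress l W m ε k.1 e := by
  have H := isClimb_progress hl hm he
  constructor
  · rintro ⟨x, hx, hxk, hcol⟩
    rw [directedChain_subPoset hl hm he] at hx
    rw [(col_eq_iff_progress_eq hm (ε := ε)).1 hcol]
    exact (H.lt_iff x.2 ((leadStrand_eq_iff hm he x.2).1 hx)).1 (subPoset_lt_iff.1 hxk).2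
  · intro hk
    obtain ⟨t, ht, h1, h2⟩ := H.exists_step (H.lt k.1 k.2)
    have h3 : t < k.1 := (H.lt_iff ht (h1.trans h2.symm)).2 (h2.trans_lt hk)
    have hcol := (col_eq_iff_progress_eq hm (ε := ε) (x := ⟨t, ht⟩) (y := k)).2 h2
    refine ⟨⟨t, ht⟩, ?_, subPoset_lt_iff.2 ⟨?_, h3⟩, hcol.symm⟩
    · rw [directedChain_subPoset hl hm he]
      exact (leadStrand_eq_iff hm he ht).2 (h1.trans h2.symm)
    · exact reflTransGen_of_relHeight_eq hl h3 ht k.2 (Nat.succPNat_inj.1 hcol)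

theorem mem_contractionIdeal_subPoset_iff (k : subPoset l W) :
    k ∈ (subPoset l W).contractionIdeal m ε ↔
      progress l W m ε k.1 e < progress l W m ε k.1 (leadStrand l ε k.1) := by
  have H := isClimb_progress hl hm he
  constructor
  · rintro ⟨x, hx, hkx, hcol⟩
    rw [directedChain_subPoset hl hm he] at hx
    have h1 := (leadStrand_eq_iff hm he x.2).1 hx
    have h2 := (col_eq_iff_progress_eq hm (ε := ε)).1 hcol
    have h3 := (subPoset_lt_iff.1 hkx).2
    refine lt_of_le_of_ne (not_lt.1 fun h => ?_) fun h => h3.ne (H.eq_of_eq k.2 h x.2 h1 h2)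
    rw [h2] at h
    exact absurd ((H.lt_iff x.2 h1).2 h) h3.asymm
  · intro hk
    obtain ⟨t, ht, h1, h2⟩ := H.exists_step (H.lt k.1 k.2)
    have h3 : k.1 < t := by
      refine lt_of_le_of_ne (not_lt.1 fun h => ?_) ?_
      · exact absurd ((H.lt_iff ht (h1.trans h2.symm)).1 h) (by rw [h2]; exact hk.asymm)
      · rintro rfl
        exact absurd h1 hk.ne
    have hcol := (col_eq_iff_progress_eq hm (ε := ε) (x := ⟨t, ht⟩) (y := k)).2 h2
    refine ⟨⟨t, ht⟩, ?_, subPoset_lt_iff.2 ⟨?_, h3⟩, hcol.symm⟩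
    · rw [directedChain_subPoset hl hm he]
      exact (leadStrand_eq_iff hm he ht).2 (h1.trans h2.symm)
    · exact reflTransGen_of_relHeight_eq hl h3 k.2 ht (Nat.succPNat_inj.1 hcol.symm)

omit hm in
theorem isCrossingOf_erase_iff (t : Fin l.length) :
    IsCrossingOf l (W.erase e) t ↔ IsCrossingOf l W t ∧ leadStrand l ε t ≠ e := by
  have hlt := hl.lowStrand_lt_highStrand t
  simp only [IsCrossingOf, Finset.mem_erase]
  cases ε
  · refine ⟨fun h => ⟨⟨h.1.2, h.2.2⟩, h.1.1⟩, fun h => ⟨⟨h.2, h.1.1⟩, ?_, h.1.2⟩⟩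
    rintro rfl
    exact absurd hlt (not_lt.2 (he.2 _ h.1.1))
  · refine ⟨fun h => ⟨⟨h.1.2, h.2.2⟩, h.2.1⟩, fun h => ⟨⟨?_, h.1.1⟩, h.2, h.1.2⟩⟩
    rintro rfl
    exact absurd hlt (not_lt.2 (he.2 _ h.1.2))

/-- The columns of the contraction are those of the arrangement without the extreme strand: the
shifted crossings are the ones above that strand. -/
theorem contraction_subPoset_col (k : subPoset l W) (hk : leadStrand l ε k.1 ≠ e) :
    ((subPoset l W).contraction m ε).col
      ⟨k, by rw [directedChain_subPoset hl hm he]; exact hk⟩ =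
      Nat.succPNat (relHeight l (W.erase e) k.1 (lowStrand l k.1)) := by
  have h1 := relHeight_erase (l := l) he.mem k.1 (lowStrand l k.1)
  have hne : progress l W m ε k.1 e ≠ progress l W m ε k.1 (leadStrand l ε k.1) := fun h =>
    hk ((leadStrand_eq_iff hm he k.2).2 h)
  have hmem := mem_contractionIdeal_subPoset_iff hl hm he k
  have hh := relHeight_highStrand k.2
  have c1 := relHeight_lt_card (l := l) (t := k.1) k.2.2
  have c2 := relHeight_lt_card (l := l) (t := k.1) he.mem
  have hlow : height l k.1 e < height l k.1 (lowStrand l k.1) ↔ _ :=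
    (relHeight_lt_iff he.mem).symm
  have hcol : (((subPoset l W).col k : ℕ+) : ℕ) = relHeight l W k.1 (lowStrand l k.1) + 1 := rfl
  apply PNat.eq
  rw [Nat.succPNat_coe, Nat.succ_eq_add_one]
  cases ε
  · simp only [progress, leadStrand] at hmem hne
    simp only [WordPoset.contraction]
    split_ifs with h
    · rw [hmem] at h
      rw [if_pos (hlow.2 h)] at h1
      rw [PNat.sub_coe, if_pos (by rw [← PNat.coe_lt_coe, hcol, PNat.one_coe]; omega), hcol,
        PNat.one_coe]
      omega
    · rw [if_neg (hlow.not.2 (hmem.not.1 h))] at h1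
      rw [hcol]; omega
  · simp only [progress, leadStrand] at hmem hne
    simp only [WordPoset.contraction]
    split_ifs with h
    · rw [hmem] at h
      rw [if_neg (hlow.not.2 (by omega))] at h1
      rw [hcol]; omega
    · rw [hmem] at h
      have hlo : relHeight l W k.1 e ≠ relHeight l W k.1 (lowStrand l k.1) := fun h2 =>
        (Finset.mem_erase.1 ((isCrossingOf_erase_iff hl he k.1).2 ⟨k.2, hk⟩).1).1
          (relHeight_injOn he.mem k.2.1 h2).symm
      rw [if_pos (hlow.2 (by omega))] at h1
      rw [PNat.sub_coe, if_pos (by rw [← PNat.coe_lt_coe, hcol, PNat.one_coe]; omega), hcol,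
        PNat.one_coe]
      omega

/-- Contraction removes the extreme strand. -/
theorem contraction_subPoset_iso :
    ((subPoset l W).contraction m ε).Iso (subPoset l (W.erase e)) := by
  have hK := directedChain_subPoset hl hm he
  have hmem : ∀ k : subPoset l W, k ∉ (subPoset l W).directedChain m ε ↔ leadStrand l ε k.1 ≠ e :=
    fun k => by rw [hK]; rfl
  let φ : {k : subPoset l W // k ∉ (subPoset l W).directedChain m ε} ≃ subPoset l (W.erase e) :=
    { toFun := fun k => ⟨k.1.1, (isCrossingOf_erase_iff hl he k.1.1).2 ⟨k.1.2, (hmem k.1).1 k.2⟩⟩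
      invFun := fun k => ⟨⟨k.1, ((isCrossingOf_erase_iff hl he k.1).1 k.2).1⟩,
        (hmem _).2 ((isCrossingOf_erase_iff hl he k.1).1 k.2).2⟩
      left_inv := fun _ => rfl
      right_inv := fun _ => rfl }
  exact ⟨⟨φ, Iff.rfl⟩, fun x => contraction_subPoset_col hl hm he x.1 ((hmem x.1).1 x.2)⟩

end Climb

/-! ### Invariance under isomorphism -/

namespace WordPoset

section Iso

variable {P : WordPoset.{u}} {Q : WordPoset.{v}} {R : WordPoset.{w}}

theorem Iso.symm (h : P.Iso Q) : Q.Iso P := by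
  obtain ⟨φ, hφ⟩ := h
  exact ⟨φ.symm, fun x => by rw [hφ, φ.apply_symm_apply]⟩

theorem Iso.trans (h : P.Iso Q) (h' : Q.Iso R) : P.Iso R := by
  obtain ⟨φ, hφ⟩ := h
  obtain ⟨ψ, hψ⟩ := h'
  exact ⟨φ.trans ψ, fun x => by rw [hφ, hψ]; rfl⟩

section

variable (φ : P ≃o Q) (hφ : ∀ x : P, P.col x = Q.col (φ x))
include hφ

theorem isDirectedChain_comp_iff {n : ℕ} {ε : Direction} (c : Fin n → P) :
    Q.IsDirectedChain n ε (φ ∘ c) ↔ P.IsDirectedChain n ε c := by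
  have h1 : StrictMono (φ ∘ c) ↔ StrictMono c :=
    ⟨fun h i j hij => φ.lt_iff_lt.1 (h hij), fun h => φ.strictMono.comp h⟩
  cases ε
  · exact and_congr h1 (forall_congr' fun i => by rw [hφ]; rfl)
  · exact and_congr h1 (forall_congr' fun i => by rw [hφ]; rfl)

theorem apply_mem_directedChain_iff {n : ℕ} {ε : Direction} (x : P) :
    φ x ∈ Q.directedChain n ε ↔ x ∈ P.directedChain n ε := by
  constructor
  · rintro ⟨c, hc, i, hi⟩
    refine ⟨φ.symm ∘ c, (isDirectedChain_comp_iff φ hφ _).1 ?_, i, ?_⟩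
    · convert hc
      funext j
      exact φ.apply_symm_apply _
    · rw [Function.comp_apply, hi, φ.symm_apply_apply]
  · rintro ⟨c, hc, i, hi⟩
    exact ⟨φ ∘ c, (isDirectedChain_comp_iff φ hφ _).2 hc, i, congrArg φ hi⟩

theorem apply_mem_contractionIdeal_iff {n : ℕ} {ε : Direction} (x : P) :
    φ x ∈ Q.contractionIdeal n ε ↔ x ∈ P.contractionIdeal n ε := by
  constructor
  · rintro ⟨y, hy, h1, h2⟩
    obtain ⟨y, rfl⟩ := φ.surjective y
    exact ⟨y, (apply_mem_directedChain_iff φ hφ y).1 hy, φ.lt_iff_lt.1 h1, by rw [hφ, hφ, h2]⟩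
  · rintro ⟨y, hy, h1, h2⟩
    exact ⟨φ y, (apply_mem_directedChain_iff φ hφ y).2 hy, φ.lt_iff_lt.2 h1, by rw [← hφ, ← hφ, h2]⟩

end

theorem Iso.ind_eq (h : P.Iso Q) (n : ℕ) (ε : Direction) : P.ind n ε = Q.ind n ε := by
  obtain ⟨φ, hφ⟩ := h
  refine Set.ncard_congr (fun x _ => φ x) ?_ (fun _ _ _ _ h => φ.injective h) ?_
  · rintro k ⟨x, hx, h1, h2⟩
    exact ⟨φ x, (apply_mem_directedChain_iff φ hφ x).2 hx, φ.lt_iff_lt.2 h1, by rw [← hφ, ← hφ, h2]⟩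
  · rintro k ⟨x, hx, h1, h2⟩
    obtain ⟨x, rfl⟩ := φ.surjective x
    obtain ⟨k, rfl⟩ := φ.surjective k
    exact ⟨k, ⟨x, (apply_mem_directedChain_iff φ hφ x).1 hx, φ.lt_iff_lt.1 h1, by rw [hφ, hφ, h2]⟩,
      rfl⟩

theorem Iso.contraction (h : P.Iso Q) (n : ℕ) (ε : Direction) :
    (P.contraction n ε).Iso (Q.contraction n ε) := by
  obtain ⟨φ, hφ⟩ := h
  have hmem : ∀ x, x ∉ P.directedChain n ε ↔ φ x ∉ Q.directedChain n ε := fun x =>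
    (apply_mem_directedChain_iff φ hφ x).not.symm
  refine ⟨⟨φ.toEquiv.subtypeEquiv hmem, φ.le_iff_le⟩, ?_⟩
  rintro ⟨x, hx⟩
  have hI := fun ε => apply_mem_contractionIdeal_iff (n := n) (ε := ε) φ hφ x
  cases ε <;> simp only [WordPoset.contraction, Equiv.subtypeEquiv, hφ] <;>
    congr 1 <;> exact propext (hI _).symm

theorem Iso.deltaIndex_eq : ∀ {P : WordPoset.{u}} {Q : WordPoset.{v}} (_ : P.Iso Q) (n : ℕ)
    (δ : Fin (n - 1) → Direction), deltaIndex n δ P = deltaIndex n δ Q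
  | _, _, _, 0, _ => rfl
  | _, _, _, 1, _ => rfl
  | _, _, h, n + 2, δ => by
    rw [deltaIndex, deltaIndex, h.ind_eq, (h.contraction _ _).deltaIndex_eq (n + 1)]

/-- `P` and `Q` have the same `δ`-index for every `δ`, where both are read with `n` columns. -/
def SameIndices (n : ℕ) (P : WordPoset.{u}) (Q : WordPoset.{v}) : Prop :=
  ∀ δ : Fin (n - 1) → Direction, deltaIndex n δ P = deltaIndex n δ Q

theorem SameIndices.congr {n : ℕ} {P' : WordPoset.{w}} {Q' : WordPoset.{x}} (h : SameIndices n P Q)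
    (hP : P.Iso P') (hQ : Q.Iso Q') : SameIndices n P' Q' := fun δ => by
  rw [← hP.deltaIndex_eq, ← hQ.deltaIndex_eq, h]

theorem SameIndices.ind_eq {n : ℕ} (h : SameIndices (n + 2) P Q) (ε : Direction) :
    P.ind (n + 2) ε = Q.ind (n + 2) ε := by
  have := congrFun (h fun _ => ε) (Fin.last n)
  simpa only [deltaIndex, Fin.snoc_last] using this

theorem SameIndices.contraction {n : ℕ} (h : SameIndices (n + 2) P Q) (ε : Direction) :
    SameIndices (n + 1) (P.contraction (n + 2) ε) (Q.contraction (n + 2) ε) := by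
  intro δ
  have := h (Fin.snoc (α := fun _ : Fin (n + 1) => Direction) δ ε)
  simp only [deltaIndex, Fin.snoc_last, Fin.snoc_castSucc] at this
  funext i
  have := congrFun this (Fin.castSucc i)
  simpa only [Fin.snoc_castSucc] using this

end Iso

end WordPoset

/-! ### What the indices count -/

section Count

variable {n : ℕ} {l l' : List (Fin n)}

theorem wordPoset_iso_subPoset (l : List (Fin n)) :
    (wordPoset l).Iso (subPoset l Finset.univ) := by
  let φ : Fin l.length ≃ {t : Fin l.length // IsCrossingOf l Finset.univ t} :=
    { toFun := fun t => ⟨t, Finset.mem_univ _, Finset.mem_univ _⟩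
      invFun := fun t => t.1
      left_inv := fun _ => rfl
      right_inv := fun _ => rfl }
  refine ⟨⟨φ, Iff.rfl⟩, fun (t : Fin l.length) => ?_⟩
  change Nat.succPNat (l.get t) = Nat.succPNat (relHeight l Finset.univ t (lowStrand l t))
  rw [Nat.succPNat_inj, relHeight, height_lowStrand]
  have : ((l.get t : Fin n) : ℕ) = (Finset.Iio (l.get t).castSucc).card := by simp
  rw [this]
  refine (Finset.card_bij (fun k _ => height l t k) ?_ ?_ ?_).symm
  · intro k hk; simpa using hk
  · intro a _ b _ h; exact height_injective _ _ h
  · intro k hk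
    refine ⟨strandAt l t k, ?_, ?_⟩
    · refine Finset.mem_filter.2 ⟨Finset.mem_univ _, ?_⟩
      rw [height, Equiv.symm_apply_apply]
      exact Finset.mem_Iio.1 hk
    · simp [height]

/-- Two reduced words with the same indices have sub-arrangements with the same indices: the
strands outside of an interval are removed one by one, from both sides. -/
theorem sameIndices_Icc (hl : IsReducedWord (longestElement n) l)
    (hl' : IsReducedWord (longestElement n) l')
    (h : WordPoset.SameIndices n (wordPoset l) (wordPoset l')) {a b : ℕ} (hab : a < b)
    (hb : b ≤ n) : WordPoset.SameIndices (b - a)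
      (subPoset l (Finset.Icc (Fin.ofNat (n + 1) a) (Fin.ofNat (n + 1) b)))
      (subPoset l' (Finset.Icc (Fin.ofNat (n + 1) a) (Fin.ofNat (n + 1) b))) := by
  have hv : ∀ c ≤ n, ((Fin.ofNat (n + 1) c : Fin (n + 1)) : ℕ) = c := fun c hc => by
    simp [Fin.ofNat, Nat.mod_eq_of_lt (Nat.lt_succ_of_le hc)]
  have step : ∀ {W : Finset (Fin (n + 1))} {m : ℕ} {ε : Direction} {e : Fin (n + 1)},
      W.card = m + 2 + 1 → IsExtremeStrand W ε e →
      WordPoset.SameIndices (m + 2) (subPoset l W) (subPoset l' W) →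
      WordPoset.SameIndices (m + 1) (subPoset l (W.erase e)) (subPoset l' (W.erase e)) :=
    fun hm he hs => (hs.contraction _).congr (contraction_subPoset_iso hl hm he)
      (contraction_subPoset_iso hl' hm he)
  have hcard : ∀ a b : ℕ, a ≤ b → b ≤ n →
      (Finset.Icc (Fin.ofNat (n + 1) a) (Fin.ofNat (n + 1) b)).card = b + 1 - a := by
    intro a b hab hb
    rw [Fin.card_Icc, hv b hb, hv a (hab.trans hb)]
  -- The `k` greatest strands are removed by descending contractions.
  have right : ∀ k, k < n → WordPoset.SameIndices (n - k)
      (subPoset l (Finset.Icc (Fin.ofNat (n + 1) 0) (Fin.ofNat (n + 1) (n - k))))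
      (subPoset l' (Finset.Icc (Fin.ofNat (n + 1) 0) (Fin.ofNat (n + 1) (n - k)))) := by
    intro k
    induction k with
    | zero =>
      intro _
      have : Finset.Icc (Fin.ofNat (n + 1) 0) (Fin.ofNat (n + 1) (n - 0)) = Finset.univ := by
        ext x
        have := x.2
        simp only [Finset.mem_Icc, Fin.le_def, hv 0 (Nat.zero_le _), hv _ (Nat.sub_le n 0),
          Finset.mem_univ, iff_true]
        omega
      rw [this]
      exact h.congr (wordPoset_iso_subPoset l) (wordPoset_iso_subPoset l')
    | succ k ih =>
      intro hk
      have h0 := ih (by omega)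
      obtain ⟨m, hm⟩ : ∃ m, n - k = m + 2 := ⟨n - k - 2, by omega⟩
      have hm' : n - (k + 1) = m + 1 := by omega
      rw [hm] at h0
      rw [hm']
      have h1 := step (ε := .D) (e := Fin.ofNat (n + 1) (m + 2))
        (hcard 0 (m + 2) (by omega) (by omega))
        ⟨by simp, fun x hx => (Finset.mem_Icc.1 hx).2⟩ h0
      convert h1 using 2 <;>
      · ext x
        simp only [Finset.mem_Icc, Finset.mem_erase, Fin.le_def, ne_eq, Fin.ext_iff,
          hv 0 (Nat.zero_le _), hv (m + 1) (by omega), hv (m + 2) (by omega)]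
        omega
  -- The strands below `a` are removed by ascending contractions.
  induction a with
  | zero =>
    have := right (n - b) (by omega)
    rwa [Nat.sub_sub_self hb] at this
  | succ a ih =>
    have h0 := ih (by omega)
    obtain ⟨m, hm⟩ : ∃ m, b - a = m + 2 := ⟨b - a - 2, by omega⟩
    have hm' : b - (a + 1) = m + 1 := by omega
    rw [hm] at h0
    rw [hm']
    have h1 := step (ε := .A) (e := Fin.ofNat (n + 1) a)
      ((hcard a b (by omega) (by omega)).trans (by omega))
      ⟨by simp only [Finset.mem_Icc, Fin.le_def, hv a (by omega : a ≤ n), hv b hb]; omega,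
        fun x hx => (Finset.mem_Icc.1 hx).1⟩ h0
    convert h1 using 2 <;>
    · ext x
      simp only [Finset.mem_Icc, Finset.mem_erase, Fin.le_def, ne_eq, Fin.ext_iff,
        hv a (by omega : a ≤ n), hv (a + 1) (by omega), hv b hb]
      omega

/-- The ascending index of the arrangement on the interval `[a, b]` of strands counts the
lexicographic triples `a < j < k ≤ b`. -/
theorem ind_subPoset_Icc (hl : IsReducedWord (longestElement n) l) {a b : Fin (n + 1)}
    (hab : a ≤ b) : (subPoset l (Finset.Icc a b)).ind (b - a) .A =
      (({p | (a < p.1 ∧ p.1 < p.2 ∧ p.2 ≤ b) ∧ crossTime l a p.1 < crossTime l p.1 p.2} :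
        Finset (Fin (n + 1) × Fin (n + 1)))).card := by
  have hm : (Finset.Icc a b).card = (b - a : ℕ) + 1 := by
    rw [Fin.card_Icc]; omega
  have he : IsExtremeStrand (Finset.Icc a b) .A a :=
    ⟨Finset.left_mem_Icc.2 hab, fun k hk => (Finset.mem_Icc.1 hk).1⟩
  have key : ∀ k : subPoset l (Finset.Icc a b),
      (∃ x ∈ (subPoset l (Finset.Icc a b)).directedChain (b - a) .A, x < k ∧
        (subPoset l (Finset.Icc a b)).col k = (subPoset l (Finset.Icc a b)).col x) ↔
      a < lowStrand l k.1 ∧ crossTime l a (lowStrand l k.1) < (k.1 : Fin l.length) := by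
    intro k
    rw [above_chain_iff hl hm he k]
    simp only [progress, leadStrand]
    rw [relHeight_lt_iff k.2.1]
    rcases (Finset.mem_Icc.1 k.2.1).1.eq_or_lt with h | h
    · rw [← h]; simp
    · have h1 := height_lt_iff_le_crossTime hl h k.1.2.le
      have h2 : height l k.1 a ≠ height l k.1 (lowStrand l k.1) := fun e =>
        h.ne (height_injective l _ e)
      rw [← not_le, h2.le_iff_lt, h1]
      simp [h]
  rw [← Set.ncard_coe_finset]
  refine Set.ncard_congr (fun k _ => (lowStrand l k.1, highStrand l k.1)) ?_ ?_ ?_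
  · intro k hk
    have hk := (key k).1 hk
    simp only [Finset.coe_filter, Finset.mem_univ, true_and, Set.mem_ofPred_eq]
    rw [crossTime_strands hl]
    exact ⟨⟨hk.1, hl.lowStrand_lt_highStrand _, (Finset.mem_Icc.1 k.2.2).2⟩, hk.2⟩
  · intro x y _ _ hxy
    obtain ⟨e1, e2⟩ := Prod.mk.inj hxy
    have h1 := crossTime_strands hl x.1
    rw [e1, e2, crossTime_strands hl] at h1
    exact (Subtype.ext (Fin.ext h1)).symm
  · rintro ⟨j, k⟩ hjk
    simp only [Finset.coe_filter, Finset.mem_univ, true_and, Set.mem_ofPred_eq] at hjk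
    obtain ⟨⟨h1, h2, h3⟩, h4⟩ := hjk
    obtain ⟨e1, e2⟩ := strands_crossTime hl h2
    have hW : IsCrossingOf l (Finset.Icc a b) ⟨_, crossTime_lt_length hl h2⟩ :=
      ⟨by rw [e1, Finset.mem_Icc]; exact ⟨h1.le, h2.le.trans h3⟩,
        by rw [e2, Finset.mem_Icc]; exact ⟨(h1.trans h2).le, h3⟩⟩
    refine ⟨⟨_, hW⟩, (key ⟨_, hW⟩).2 ?_, Prod.ext e1 e2⟩
    change a < lowStrand l ⟨crossTime l j k, _⟩ ∧
      crossTime l a (lowStrand l ⟨crossTime l j k, _⟩) < crossTime l j k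
    rw [e1]
    exact ⟨h1, h4⟩

end Count

/-! ### The orientations of the triples of strands -/

section Triples

variable {n : ℕ} {l l' : List (Fin n)} (hl : IsReducedWord (longestElement n) l)
  (hl' : IsReducedWord (longestElement n) l')
include hl hl'

/-- If the triples with a smaller span have the same orientations in both words, and the triples
`a < j < b` have the same number of lexicographic ones, then these triples have the same
orientations too: `a < j < b` is lexicographic if the strand `a` meets `j` before `b`, thus the
`j` concerned form an initial segment, of known size, in the order in which the strand `a` meets
the strands between `a` and `b`; and this order is given by the triples of smaller span. -/
theorem lexicographic_of_card_eq {a b : Fin (n + 1)}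
    (hsmall : ∀ j k, a < j → j < k → k < b →
      (crossTime l a j < crossTime l j k ↔ crossTime l' a j < crossTime l' j k))
    (hcard :
      ({j | (a < j ∧ j < b) ∧ crossTime l a j < crossTime l j b} : Finset (Fin (n + 1))).card =
      ({j | (a < j ∧ j < b) ∧ crossTime l' a j < crossTime l' j b} : Finset (Fin (n + 1))).card)
    {j : Fin (n + 1)} (haj : a < j) (hjb : j < b)
    (h : crossTime l a j < crossTime l j b) : crossTime l' a j < crossTime l' j b := by
  -- The strand `a` meets the strands between `a` and `b` in the same order in both words.
  have horder : ∀ j k, a < j → j < b → a < k → k < b →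
      crossTime l' a j < crossTime l' a k → crossTime l a j < crossTime l a k := by
    intro j k h1 h2 h3 h4 h5
    rcases lt_trichotomy j k with h6 | rfl | h6
    · have t1 := crossTime_triple hl h1 h6
      have t2 := crossTime_triple hl' h1 h6
      have := hsmall j k h1 h6 h4
      omega
    · exact absurd h5 (lt_irrefl _)
    · have t1 := crossTime_triple hl h3 h6
      have t2 := crossTime_triple hl' h3 h6
      have := hsmall k j h3 h6 h2
      omega
  by_contra hno
  refine absurd hcard (ne_of_gt (Finset.card_lt_card
    (Finset.ssubset_iff_of_subset (fun k hk => ?_) |>.2 ⟨j, ?_, ?_⟩)))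
  · simp only [Finset.mem_filter, Finset.mem_univ, true_and] at hk ⊢
    refine ⟨hk.1, ?_⟩
    have t1 := crossTime_triple hl haj hjb
    have t2 := crossTime_triple hl' haj hjb
    have t3 := crossTime_triple hl hk.1.1 hk.1.2
    have t4 := crossTime_triple hl' hk.1.1 hk.1.2
    have := horder k j hk.1.1 hk.1.2 haj hjb (by omega)
    omega
  · simp [haj, hjb, h]
  · simp [hno]

/-- Words with the same indices have the same lexicographic triples. -/
theorem lexicographic_iff_of_sameIndices
    (h : WordPoset.SameIndices n (wordPoset l) (wordPoset l')) {a j b : Fin (n + 1)} (haj : a < j)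
    (hjb : j < b) :
    crossTime l a j < crossTime l j b ↔ crossTime l' a j < crossTime l' j b := by
  induction hd : (b - a : ℕ) using Nat.strong_induction_on generalizing a j b with
  | _ d ih =>
  have hsmall : ∀ j k, a < j → j < k → k < b →
      (crossTime l a j < crossTime l j k ↔ crossTime l' a j < crossTime l' j k) :=
    fun j k h1 h2 h3 => ih (k - a) (by omega) h1 h2 rfl
  have hind : (subPoset l (Finset.Icc a b)).ind (b - a) .A =
      (subPoset l' (Finset.Icc a b)).ind (b - a) .A := by
    have h1 := sameIndices_Icc hl hl' h (haj.trans hjb) (Nat.le_of_lt_succ b.2)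
    obtain ⟨m, hm⟩ : ∃ m, (b - a : ℕ) = m + 2 := ⟨b - a - 2, by omega⟩
    rw [hm] at h1 ⊢
    simpa using h1.ind_eq .A
  rw [ind_subPoset_Icc hl (haj.trans hjb).le, ind_subPoset_Icc hl' (haj.trans hjb).le] at hind
  -- The triples counted are those with `k < b`, known by induction, and those with `k = b`.
  have hsplit : ∀ l : List (Fin n),
      ({p | (a < p.1 ∧ p.1 < p.2 ∧ p.2 ≤ b) ∧ crossTime l a p.1 < crossTime l p.1 p.2} :
        Finset (Fin (n + 1) × Fin (n + 1))).card =
      ({p | (a < p.1 ∧ p.1 < p.2 ∧ p.2 < b) ∧ crossTime l a p.1 < crossTime l p.1 p.2} :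
        Finset (Fin (n + 1) × Fin (n + 1))).card +
      ({j | (a < j ∧ j < b) ∧ crossTime l a j < crossTime l j b} : Finset (Fin (n + 1))).card := by
    intro l
    have hinj : Function.Injective fun j : Fin (n + 1) => (j, b) := fun _ _ h => (Prod.mk.inj h).1
    rw [← Finset.card_image_of_injective _ hinj, ← Finset.card_union_of_disjoint]
    · congr 1
      ext ⟨j, k⟩
      simp only [Finset.mem_filter, Finset.mem_univ, true_and, Finset.mem_union, Finset.mem_image,
        Prod.mk.injEq]
      constructor
      · rintro ⟨⟨h1, h2, h3⟩, h4⟩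
        rcases h3.eq_or_lt with rfl | h3
        · exact .inr ⟨j, ⟨⟨h1, h2⟩, h4⟩, rfl, rfl⟩
        · exact .inl ⟨⟨h1, h2, h3⟩, h4⟩
      · rintro (⟨⟨h1, h2, h3⟩, h4⟩ | ⟨j, ⟨⟨h1, h2⟩, h4⟩, rfl, rfl⟩)
        · exact ⟨⟨h1, h2, h3.le⟩, h4⟩
        · exact ⟨⟨h1, h2, le_rfl⟩, h4⟩
    · rw [Finset.disjoint_left]
      rintro ⟨j, k⟩ h1 h2
      simp only [Finset.mem_filter, Finset.mem_univ, true_and, Finset.mem_image,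
        Prod.mk.injEq] at h1 h2
      obtain ⟨_, _, _, rfl⟩ := h2
      exact lt_irrefl _ h1.1.2.2
  rw [hsplit l, hsplit l', Finset.filter_congr (q := fun p : Fin (n + 1) × Fin (n + 1) =>
    (a < p.1 ∧ p.1 < p.2 ∧ p.2 < b) ∧ crossTime l' a p.1 < crossTime l' p.1 p.2)
    fun p _ => and_congr_right fun hp => hsmall _ _ hp.1 hp.2.1 hp.2.2] at hind
  have hcard := Nat.add_left_cancel hind
  exact ⟨lexicographic_of_card_eq hl hl' hsmall hcard haj hjb,
    lexicographic_of_card_eq hl' hl (fun j k h1 h2 h3 => (hsmall j k h1 h2 h3).symm) hcard.symm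
      haj hjb⟩

end Triples

/-! ### Words with the same order of crossings are in the same commutation class -/

/-- The crossings of a word, as pairs of strands, when the word is read from the arrangement `σ` of
the strands. -/
def crossings {n : ℕ} : Equiv.Perm (Fin (n + 1)) → List (Fin n) →
    List (Fin (n + 1) × Fin (n + 1))
  | _, [] => []
  | σ, i :: l => (σ i.castSucc, σ i.succ) :: crossings (σ * simpleTransposition i) l

/-- The two crossings have a strand in common. -/
def Meets {n : ℕ} (p q : Fin (n + 1) × Fin (n + 1)) : Prop :=
  p.1 = q.1 ∨ p.1 = q.2 ∨ p.2 = q.1 ∨ p.2 = q.2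

section Commutation

variable {n : ℕ}

theorem Meets.symm {p q : Fin (n + 1) × Fin (n + 1)} (h : Meets p q) : Meets q p := by
  rcases h with h | h | h | h <;> simp [Meets, h]

theorem TwoMove.cons {l l' : List (Fin n)} (i : Fin n) (h : TwoMove l l') :
    TwoMove (i :: l) (i :: l') := by
  obtain ⟨u, v, j, k, h⟩ := h
  exact TwoMove.swap (i :: u) v j k h

theorem CommutationEquiv.cons {l l' : List (Fin n)} (i : Fin n) (h : CommutationEquiv l l') :
    CommutationEquiv (i :: l) (i :: l') :=
  Relation.ReflTransGen.lift (i :: ·) (fun _ _ h => TwoMove.cons i h) _ _ h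

theorem simpleTransposition_apply_of_far {i j : Fin n} (h : 1 < |((i : ℕ) : ℤ) - ((j : ℕ) : ℤ)|) :
    simpleTransposition i j.castSucc = j.castSucc ∧ simpleTransposition i j.succ = j.succ := by
  have : (i : ℕ) ≠ j ∧ (i : ℕ) ≠ j + 1 ∧ (i : ℕ) + 1 ≠ j := by
    rw [lt_abs] at h; omega
  constructor <;> refine Equiv.swap_apply_of_ne_of_ne ?_ ?_ <;>
    simp only [ne_eq, Fin.ext_iff, Fin.val_castSucc, Fin.val_succ] <;> omega

theorem simpleTransposition_comm_of_far {i j : Fin n}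
    (h : 1 < |((i : ℕ) : ℤ) - ((j : ℕ) : ℤ)|) :
    simpleTransposition i * simpleTransposition j =
      simpleTransposition j * simpleTransposition i := by
  obtain ⟨h1, h2⟩ := simpleTransposition_apply_of_far h
  conv_lhs => rw [simpleTransposition.eq_1 (i := j), Equiv.mul_swap_eq_swap_mul, h1, h2]
  rfl

/-- A crossing that can be performed at the beginning of a word, and that meets no crossing before
it, can be moved to the front of the word by 2-moves. -/
theorem exists_cons_of_crossings_eq (i : Fin n) (u v : List (Fin (n + 1) × Fin (n + 1)))
    (σ : Equiv.Perm (Fin (n + 1))) (l : List (Fin n))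
    (h : crossings σ l = u ++ (σ i.castSucc, σ i.succ) :: v)
    (hu : ∀ q ∈ u, ¬ Meets q (σ i.castSucc, σ i.succ)) :
    ∃ r, CommutationEquiv (i :: r) l ∧ crossings (σ * simpleTransposition i) r = u ++ v := by
  induction u generalizing σ l with
  | nil =>
    rcases l with _ | ⟨j, l⟩
    · simp [crossings] at h
    · simp only [crossings, List.nil_append, List.cons.injEq, Prod.mk.injEq,
        EmbeddingLike.apply_eq_iff_eq, Fin.castSucc_inj, Fin.succ_inj, and_self] at h
      obtain ⟨rfl, h⟩ := h
      exact ⟨l, .refl, h⟩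
  | cons q u ih =>
    rcases l with _ | ⟨j, l⟩
    · simp [crossings] at h
    · simp only [crossings, List.cons_append, List.cons.injEq] at h
      obtain ⟨rfl, h⟩ := h
      have hq := hu _ List.mem_cons_self
      simp only [Meets, EmbeddingLike.apply_eq_iff_eq, Fin.ext_iff, Fin.val_castSucc,
        Fin.val_succ] at hq
      have hji : 1 < |((j : ℕ) : ℤ) - ((i : ℕ) : ℤ)| := by rw [lt_abs]; omega
      have hij : 1 < |((i : ℕ) : ℤ) - ((j : ℕ) : ℤ)| := by rwa [abs_sub_comm]
      obtain ⟨h1, h2⟩ := simpleTransposition_apply_of_far hji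
      obtain ⟨h3, h4⟩ := simpleTransposition_apply_of_far hij
      obtain ⟨r, hr, hr'⟩ := ih (σ * simpleTransposition j) l
        (by simp only [Equiv.Perm.mul_apply, h1, h2]; exact h)
        (by simp only [Equiv.Perm.mul_apply, h1, h2]; exact fun p hp => hu p (by simp [hp]))
      refine ⟨j :: r, .head (TwoMove.swap [] r i j hij) (hr.cons j), ?_⟩
      simp only [crossings, Equiv.Perm.mul_apply, h3, h4, List.cons_append]
      rw [mul_assoc, simpleTransposition_comm_of_far hij, ← mul_assoc, hr']

/-- Two words with the same crossings, such that crossings on a common strand occur in the same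
order, are in the same commutation class. -/
theorem commutationEquiv_of_crossings
    {R : Fin (n + 1) × Fin (n + 1) → Fin (n + 1) × Fin (n + 1) → Prop}
    (hR : ∀ p q, R p q → ¬ R q p) (l l' : List (Fin n)) (σ : Equiv.Perm (Fin (n + 1)))
    (hperm : (crossings σ l).Perm (crossings σ l'))
    (h : (crossings σ l).Pairwise fun p q => Meets p q → R p q)
    (h' : (crossings σ l').Pairwise fun p q => Meets p q → R p q) : CommutationEquiv l l' := by
  induction l generalizing l' σ with
  | nil =>
    rcases l' with _ | ⟨j, l'⟩
    · exact .refl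
    · simp [crossings] at hperm
  | cons i l ih =>
    simp only [crossings, List.pairwise_cons] at h hperm
    obtain ⟨u, v, huv, hu⟩ := List.eq_append_cons_of_mem (hperm.subset List.mem_cons_self)
    rw [huv] at h' hperm
    obtain ⟨r, hr, hr'⟩ := exists_cons_of_crossings_eq i u v σ l' huv fun q hq hm => by
      have h1 := (List.pairwise_append.1 h').2.2 q hq _ List.mem_cons_self hm
      have h2 : q ∈ (σ i.castSucc, σ i.succ) :: crossings (σ * simpleTransposition i) l :=
        hperm.symm.subset (by simp [hq])
      rcases List.mem_cons.1 h2 with rfl | h2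
      · exact hu hq
      · exact hR _ _ h1 (h.1 q h2 hm.symm)
    refine (CommutationEquiv.cons i (ih r (σ * simpleTransposition i) ?_ h.2 ?_)).trans hr
    · rw [hr']
      exact (List.perm_cons _).1 (hperm.trans List.perm_middle)
    · rw [hr']
      exact h'.sublist (List.Sublist.append_left (List.sublist_cons_self _ _) _)

theorem crossings_length (σ : Equiv.Perm (Fin (n + 1))) (l : List (Fin n)) :
    (crossings σ l).length = l.length := by
  induction l generalizing σ with
  | nil => rfl
  | cons i l ih => simp [crossings, ih]

theorem crossings_getElem (σ : Equiv.Perm (Fin (n + 1))) (l : List (Fin n)) (t : ℕ)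
    (ht : t < l.length) :
    (crossings σ l)[t]'(by rwa [crossings_length]) =
      (σ (lowStrand l ⟨t, ht⟩), σ (highStrand l ⟨t, ht⟩)) := by
  induction l generalizing σ t with
  | nil => simp at ht
  | cons i l ih =>
    rcases t with _ | t
    · simp [crossings, lowStrand, highStrand, strandAt, wordProd]
    · simp only [crossings, List.getElem_cons_succ]
      rw [ih _ t (by simpa using ht)]
      simp [lowStrand, highStrand, strandAt, wordProd]

theorem crossings_one_getElem (l : List (Fin n)) (t : ℕ) (ht : t < l.length) :
    (crossings 1 l)[t]'(by rwa [crossings_length]) =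
      (lowStrand l ⟨t, ht⟩, highStrand l ⟨t, ht⟩) :=
  crossings_getElem 1 l t ht

theorem pairwise_crossings {l : List (Fin n)} (hl : IsReducedWord (longestElement n) l) :
    (crossings 1 l).Pairwise fun p q =>
      (p.1 < p.2 ∧ q.1 < q.2) ∧ crossTime l p.1 p.2 < crossTime l q.1 q.2 := by
  rw [List.pairwise_iff_getElem]
  intro i j hi hj hij
  rw [crossings_length] at hi hj
  rw [crossings_one_getElem l i hi, crossings_one_getElem l j hj]
  refine ⟨⟨hl.lowStrand_lt_highStrand _, hl.lowStrand_lt_highStrand _⟩, ?_⟩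
  simpa only [crossTime_strands hl] using hij

theorem mem_crossings_iff {l : List (Fin n)} (hl : IsReducedWord (longestElement n) l)
    (p : Fin (n + 1) × Fin (n + 1)) : p ∈ crossings 1 l ↔ p.1 < p.2 := by
  constructor
  · intro h
    obtain ⟨t, ht, rfl⟩ := List.getElem_of_mem h
    rw [crossings_length] at ht
    rw [crossings_one_getElem l t ht]
    exact hl.lowStrand_lt_highStrand _
  · intro h
    obtain ⟨h1, h2⟩ := strands_crossTime hl h
    have := crossings_one_getElem l _ (crossTime_lt_length hl h)
    rw [h1, h2] at this
    exact List.mem_of_getElem this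

/-- Reduced words of the longest element with the same lexicographic triples are in the same
commutation class. -/
theorem commutationEquiv_of_lexicographic_iff {l l' : List (Fin n)}
    (hl : IsReducedWord (longestElement n) l) (hl' : IsReducedWord (longestElement n) l')
    (h : ∀ a j b : Fin (n + 1), a < j → j < b →
      (crossTime l a j < crossTime l j b ↔ crossTime l' a j < crossTime l' j b)) :
    CommutationEquiv l l' := by
  have hmeet : ∀ p q : Fin (n + 1) × Fin (n + 1), p.1 < p.2 → q.1 < q.2 → Meets p q →
      crossTime l' p.1 p.2 < crossTime l' q.1 q.2 → crossTime l p.1 p.2 < crossTime l q.1 q.2 := by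
    have H : ∀ a j b, a < j → j < b → _ := fun a j b h1 h2 =>
      And.intro (h a j b h1 h2) (And.intro (crossTime_triple hl h1 h2) (crossTime_triple hl' h1 h2))
    rintro ⟨a, b⟩ ⟨c, d⟩ h1 h2 h3 h4
    simp only [Meets] at h1 h2 h3 h4 ⊢
    rcases h3 with rfl | rfl | rfl | rfl
    · rcases lt_trichotomy b d with h5 | rfl | h5
      · have := H _ _ _ h1 h5; omega
      · exact absurd h4 (lt_irrefl _)
      · have := H _ _ _ h2 h5; omega
    · have := H _ _ _ h2 h1; omega
    · have := H _ _ _ h1 h2; omega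
    · rcases lt_trichotomy a c with h5 | rfl | h5
      · have := H _ _ _ h5 h2; omega
      · exact absurd h4 (lt_irrefl _)
      · have := H _ _ _ h5 h1; omega
  refine commutationEquiv_of_crossings
    (R := fun p q => crossTime l p.1 p.2 < crossTime l q.1 q.2) (fun _ _ => Nat.lt_asymm) l l' 1
    ?_ ((pairwise_crossings hl).imp fun h _ => h.2)
    ((pairwise_crossings hl').imp fun {p q} h hm => hmeet p q h.1.1 h.1.2 hm h.2)
  have nodup : ∀ {l : List (Fin n)}, IsReducedWord (longestElement n) l →
      (crossings 1 l).Nodup := fun hl =>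
    (pairwise_crossings hl).imp fun {p q} h => by rintro rfl; exact lt_irrefl _ h.2
  exact (List.perm_ext_iff_of_nodup (nodup hl) (nodup hl')).2 fun p => by
    rw [mem_crossings_iff hl, mem_crossings_iff hl']

/-! ### The word poset of a commutation class -/

/-- A 2-move exchanges two positions that are incomparable in the word poset, and the exchange is
an isomorphism. -/
theorem TwoMove.iso {l l' : List (Fin n)} (h : TwoMove l l') :
    (wordPoset l).Iso (wordPoset l') := by
  obtain ⟨u, v, i, j, hij⟩ := h
  have hlen : (u ++ i :: j :: v).length = (u ++ j :: i :: v).length := by simp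
  have h0 : u.length < (u ++ i :: j :: v).length := by simp
  have h1 : u.length + 1 < (u ++ i :: j :: v).length := by simp
  let e : Fin (u ++ i :: j :: v).length ≃ Fin (u ++ j :: i :: v).length :=
    (Equiv.swap ⟨u.length, h0⟩ ⟨u.length + 1, h1⟩).trans (finCongr hlen)
  have he : ∀ a, (e a : ℕ) =
      if (a : ℕ) = u.length then u.length + 1
      else if (a : ℕ) = u.length + 1 then u.length else a := by
    intro a
    simp only [e, Equiv.trans_apply, finCongr_apply, Fin.val_cast, Equiv.swap_apply_def,
      Fin.ext_iff]
    split_ifs <;> rfl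
  have hget : ∀ a, (u ++ j :: i :: v).get (e a) = (u ++ i :: j :: v).get a := by
    intro a
    have hea := he a
    simp only [List.get_eq_getElem, hea]
    split_ifs with h2 h3
    · simp [h2]
    · simp [h3]
    · rcases lt_or_ge (a : ℕ) u.length with h4 | h4
      · rw [List.getElem_append_left h4, List.getElem_append_left h4]
      · obtain ⟨k, hk⟩ : ∃ k, (a : ℕ) = u.length + (k + 2) := ⟨a - u.length - 2, by omega⟩
        simp [hk]
  have hcol : ((u ++ i :: j :: v).get ⟨u.length, h0⟩ : Fin n) = i ∧
      ((u ++ i :: j :: v).get ⟨u.length + 1, h1⟩ : Fin n) = j := by simp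
  have hrel : ∀ a b, wordRel (u ++ j :: i :: v) (e a) (e b) ↔ wordRel (u ++ i :: j :: v) a b := by
    intro a b
    rw [wordRel, wordRel, hget, hget]
    refine and_congr_left fun hab => ?_
    -- The two exchanged positions are not related, their letters being far apart.
    have hne : ¬ ((a : ℕ) = u.length ∧ (b : ℕ) = u.length + 1) := by
      rintro ⟨ha, hb⟩
      rw [show a = ⟨u.length, h0⟩ from Fin.ext ha, show b = ⟨u.length + 1, h1⟩ from Fin.ext hb,
        hcol.1, hcol.2] at hab
      exact hij.ne' hab
    have hne' : ¬ ((b : ℕ) = u.length ∧ (a : ℕ) = u.length + 1) := by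
      rintro ⟨hb, ha⟩
      rw [show b = ⟨u.length, h0⟩ from Fin.ext hb, show a = ⟨u.length + 1, h1⟩ from Fin.ext ha,
        hcol.1, hcol.2, abs_sub_comm] at hab
      exact hij.ne' hab
    rw [Fin.lt_def, Fin.lt_def, he, he]
    split_ifs <;> omega
  have hle : ∀ a b, Relation.ReflTransGen (wordRel (u ++ j :: i :: v)) (e a) (e b) ↔
      Relation.ReflTransGen (wordRel (u ++ i :: j :: v)) a b := by
    intro a b
    constructor
    · intro h
      have := Relation.ReflTransGen.lift (p := wordRel (u ++ i :: j :: v)) e.symm (fun c d hcd => by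
        change wordRel _ (e.symm c) (e.symm d)
        rw [← hrel, e.apply_symm_apply, e.apply_symm_apply]; exact hcd) _ _ h
      rwa [Function.onFun, e.symm_apply_apply, e.symm_apply_apply] at this
    · exact Relation.ReflTransGen.lift e (fun c d hcd => (hrel c d).2 hcd) _ _
  exact ⟨⟨e, fun {a b} => hle a b⟩, fun a =>
    congrArg (fun k : Fin n => Nat.succPNat k) (hget a).symm⟩

theorem CommutationEquiv.iso {l l' : List (Fin n)} (h : CommutationEquiv l l') :
    (wordPoset l).Iso (wordPoset l') := by
  induction h with
  | refl => exact ⟨OrderIso.refl _, fun _ => rfl⟩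
  | tail _ h ih => exact ih.trans h.iso

end Commutation

theorem theorem5p1 (n : ℕ) (hn : 1 ≤ n) :
    (∀ (P : WordPoset.{u}) (Q : WordPoset.{v}),
      P.IsWordPosetOf (longestElement n) → Q.IsWordPosetOf (longestElement n) →
      (∀ δ : Fin (n - 1) → Direction,
        WordPoset.deltaIndex n δ P = WordPoset.deltaIndex n δ Q) →
      P.Iso Q) ∧
    (∀ i j : List (Fin n),
      IsReducedWord (longestElement n) i → IsReducedWord (longestElement n) j →
      (∀ δ : Fin (n - 1) → Direction, wordDeltaIndex δ i = wordDeltaIndex δ j) →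
      CommutationEquiv i j) := by
  have main : ∀ i j : List (Fin n),
      IsReducedWord (longestElement n) i → IsReducedWord (longestElement n) j →
      WordPoset.SameIndices n (wordPoset i) (wordPoset j) → CommutationEquiv i j :=
    fun i j hi hj h => commutationEquiv_of_lexicographic_iff hi hj fun _ _ _ h1 h2 =>
      lexicographic_iff_of_sameIndices hi hj h h1 h2
  refine ⟨?_, main⟩
  rintro P Q ⟨i, hi, hP⟩ ⟨j, hj, hQ⟩ h
  have hij := main i j hi hj (WordPoset.SameIndices.congr (P := P) (Q := Q) h hP hQ)
  exact hP.trans (hij.iso.trans hQ.symm)
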